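/- Let $n\ge 2$ and let $\Omega\subset\mathbb R^n$ be open. Let $F\in\mathcal{DM}^{\mathrm{ext}}(\Omega)$, i.e. $F$ is a finite $\mathbb R^n$-valued Radon measure on $\Omega$ with $$|\operatorname{div}F|(\Omega):=\sup\Big\{\int_\Omega\nabla\varphi\cdot dF:\ \varphi\in C_c^1(\Omega),\ |\varphi|\le1\Big\}<\infty .$$ The distributional divergence of such a field is a finite signed Radon measure $\operatorname{div}F$ on $\Omega$, determined by $\int_\Omega\varphi\,d(\operatorname{div}F)=-\int_\Omega\nabla\varphi\cdot dF$ for all $\varphi\in C_c^\infty(\Omega)$. For $\phi\in W^{1,\infty}(\Omega)$ (identified with its continuous representative) one has $\phi F\in\mathcal{DM}^{\mathrm{ext}}(\Omega)$, and the normal trace of $F$ on the boundary of a Borel set $E\Subset\Omega$ is defined by $$\langle F\cdot\nu,\phi\rangle_{\partial E}:=-\operatorname{div}(\phi F)(E)\qquad\text{for }\phi\in W^{1,\infty}(\Omega),$$ where $E\Subset\Omega$ means that $\overline E$ is compact and contained in $\Omega$. Let $U\Subset\Omega$ be open and, for $\varepsilon>0$, put $U^\varepsilon:=\{x\in U:\operatorname{dist}(x,\partial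 U)>\varepsilon\}$. Then there is an $\mathcal L^1$-null set $\mathcal N\subset(0,\infty)$ such that for every $\varepsilon\in(0,\infty)\setminus\mathcal N$ there exists a finite signed Radon measure $(F\cdot\nu)_{\partial U^\varepsilon}$ supported on $\partial U^\varepsilon$ with $$\langle F\cdot\nu,\phi\rangle_{\partial U^\varepsilon}=\int_{\partial U^\varepsilon}\phi\,d(F\cdot\nu)_{\partial U^\varepsilon}\qquad\text{for all }\phi\in W^{1,\infty}(\Omega).$$ Moreover, for every sequence $\varepsilon_k\to0$ with $\varepsilon_k\in(0,\infty)\setminus\mathcal N$, $$\langle F\cdot\nu,\phi\rangle_{\partial U}=\lim_{k\to\infty}\int_{\partial U^{\varepsilon_k}}\phi\,d(F\cdot\nu)_{\partial U^{\varepsilon_k}}\qquad\text{for all }\phi\in W^{1,\infty}(\Omega).$$ -/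

import Mathlib

open MeasureTheory Set Filter Topology
open scoped ContDiff Gradient ENNReal

namespace DivMeasure

/-- `IsTest k Ω φ`: `φ` is a real test function of class `C^k` on `ℝⁿ` whose support is compact and
contained in `Ω`, that is, `φ ∈ C_c^k(Ω)`. -/
structure IsTest {n : ℕ} (k : WithTop ℕ∞) (Ω : Set (EuclideanSpace ℝ (Fin n)))
    (φ : EuclideanSpace ℝ (Fin n) → ℝ) : Prop where
  contDiff : ContDiff ℝ k φ
  hasCompactSupport : HasCompactSupport φ
  tsupport_subset : tsupport φ ⊆ Ω

/-- The number `∫ ∇φ · dF` for a vector-valued measure `F`. -/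
noncomputable def gradPairing {n : ℕ}
    (F : VectorMeasure (EuclideanSpace ℝ (Fin n)) (EuclideanSpace ℝ (Fin n)))
    (φ : EuclideanSpace ℝ (Fin n) → ℝ) : ℝ :=
  ∫ᵛ x, ∇ φ x ∂[innerSL ℝ; F]

/-- `|div F|(Ω) = sup {∫_Ω ∇φ · dF : φ ∈ C_c^1(Ω), |φ| ≤ 1}`. (The set of these numbers is symmetric
and contains `0`, so truncating negative values does not change the supremum.) -/
noncomputable def divVariation {n : ℕ} (Ω : Set (EuclideanSpace ℝ (Fin n)))
    (F : VectorMeasure (EuclideanSpace ℝ (Fin n)) (EuclideanSpace ℝ (Fin n))) : ℝ≥0∞ :=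
  ⨆ (φ : EuclideanSpace ℝ (Fin n) → ℝ) (_ : IsTest 1 Ω φ) (_ : ∀ x, |φ x| ≤ 1),
    ENNReal.ofReal (gradPairing F φ)

/-- `F ∈ DM^ext(Ω)`: `F` is a finite `ℝⁿ`-valued Borel measure on `Ω` with `|div F|(Ω) < ∞`.
Measures on `Ω` are encoded as measures on `ℝⁿ` that give no mass to the complement of `Ω`. -/
structure IsDMExt {n : ℕ} (Ω : Set (EuclideanSpace ℝ (Fin n)))
    (F : VectorMeasure (EuclideanSpace ℝ (Fin n)) (EuclideanSpace ℝ (Fin n))) : Prop where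
  concentrated : F.variation Ωᶜ = 0
  variation_lt_top : F.variation univ < ⊤
  divVariation_lt_top : divVariation Ω F < ⊤

/-- The signed measure `μ` on `Ω` is the distributional divergence of `F` in `Ω`:
`∫_Ω φ dμ = -∫_Ω ∇φ · dF` for all `φ ∈ C_c^∞(Ω)`. -/
structure IsDivergence {n : ℕ} (Ω : Set (EuclideanSpace ℝ (Fin n)))
    (F : VectorMeasure (EuclideanSpace ℝ (Fin n)) (EuclideanSpace ℝ (Fin n)))
    (μ : SignedMeasure (EuclideanSpace ℝ (Fin n))) : Prop where
  concentrated : μ.variation Ωᶜ = 0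
  integral_eq : ∀ φ : EuclideanSpace ℝ (Fin n) → ℝ, IsTest ∞ Ω φ →
    ∫ᵛ x, φ x ∂•μ = -gradPairing F φ

open Classical in
/-- The divergence of `F` in `Ω` as a signed measure on `Ω`. When `F ∈ DM^ext(Ω)`, there is exactly
one measure with the property `IsDivergence Ω F`; the value is `0` if there is none. -/
noncomputable def divergence {n : ℕ} (Ω : Set (EuclideanSpace ℝ (Fin n)))
    (F : VectorMeasure (EuclideanSpace ℝ (Fin n)) (EuclideanSpace ℝ (Fin n))) :
    SignedMeasure (EuclideanSpace ℝ (Fin n)) :=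
  if h : ∃ μ, IsDivergence Ω F μ then h.choose else 0

/-- `g` is the weak gradient of `φ` in `Ω`. -/
def IsWeakGradient {n : ℕ} (Ω : Set (EuclideanSpace ℝ (Fin n)))
    (φ : EuclideanSpace ℝ (Fin n) → ℝ)
    (g : EuclideanSpace ℝ (Fin n) → EuclideanSpace ℝ (Fin n)) : Prop :=
  ∀ ψ : EuclideanSpace ℝ (Fin n) → ℝ, IsTest ∞ Ω ψ →
    ∫ x in Ω, φ x • ∇ ψ x = -∫ x in Ω, ψ x • g x

/-- `φ ∈ W^{1,∞}(Ω)`: `φ` and its weak gradient are essentially bounded on `Ω`. As usual, an element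
of this space is identified with its continuous representative; values outside `Ω` are irrelevant. -/
structure MemW1Infty {n : ℕ} (Ω : Set (EuclideanSpace ℝ (Fin n)))
    (φ : EuclideanSpace ℝ (Fin n) → ℝ) : Prop where
  continuousOn : ContinuousOn φ Ω
  memLp : MemLp φ ⊤ (volume.restrict Ω)
  exists_weakGradient : ∃ g : EuclideanSpace ℝ (Fin n) → EuclideanSpace ℝ (Fin n),
    MemLp g ⊤ (volume.restrict Ω) ∧ IsWeakGradient Ω φ g

/-- The product `φ F` of a function and a vector-valued measure. -/
noncomputable def mulField {n : ℕ} (φ : EuclideanSpace ℝ (Fin n) → ℝ)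
    (F : VectorMeasure (EuclideanSpace ℝ (Fin n)) (EuclideanSpace ℝ (Fin n))) :
    VectorMeasure (EuclideanSpace ℝ (Fin n)) (EuclideanSpace ℝ (Fin n)) :=
  F.withDensity φ (ContinuousLinearMap.lsmul ℝ ℝ)

/-- The normal trace `⟨F · ν, φ⟩_{∂E} = -div(φ F)(E)` of `F ∈ DM^ext(Ω)` on the boundary of a Borel
set `E` compactly contained in `Ω`, tested against `φ ∈ W^{1,∞}(Ω)` (interior normal convention). -/
noncomputable def normalTrace {n : ℕ} (Ω : Set (EuclideanSpace ℝ (Fin n)))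
    (F : VectorMeasure (EuclideanSpace ℝ (Fin n)) (EuclideanSpace ℝ (Fin n)))
    (E : Set (EuclideanSpace ℝ (Fin n))) (φ : EuclideanSpace ℝ (Fin n) → ℝ) : ℝ :=
  -(divergence Ω (mulField φ F) E)

/-- The inner parallel set `U^ε = {x ∈ U : dist(x, ∂U) > ε}`. -/
def innerSet {n : ℕ} (U : Set (EuclideanSpace ℝ (Fin n))) (ε : ℝ) :
    Set (EuclideanSpace ℝ (Fin n)) :=
  {x ∈ U | ε < Metric.infDist x (frontier U)}

end DivMeasure

/-! Write `D` for the divergence of `φ F` and `d` for the distance to the complement of `U`, so that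
`U^ε = {d > ε}`.

That `D` is a finite measure comes from the product rule `φ ∇ψ = ∇(φ ψ) - ψ ∇φ`, applied to
mollifications of `φ` (`exists_abs_gradPairing_mulField_le`). It bounds `∫ φ ∇ψ · dF` by a multiple
of `sup |ψ|`, and Hahn-Banach with Riesz representation (`exists_signedMeasure_of_bound`) yields
`D`.

For the trace on `∂U^ε`, test `D` with a smooth step of `d` rising from `0` to `1` on `[ε, ε + h]`.
As `h → 0` the integrals tend to `D(U^ε)`. Since `d` is 1-Lipschitz, they are at most `C/h` times
the integral of `|φ|` against `|F|` over the layer `{ε < d < ε + h}` (`abs_integral_smoothStep_le`).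
The mass of that layer is at most an increment of the monotone function `m(t) = |F|({d ≤ t})`, which
by Lebesgue's theorem is differentiable for almost every `ε`. At such `ε` the limit gives `|D(U^ε)|
≤ C (|m'(ε)| + 1) sup |φ|`, the supremum being over `∂U^ε` only
(`exists_abs_divergence_lt_depth_le`). The same Riesz lemma, now on the compact set `∂U^ε`, produces
the trace measure.

The limit statement is dominated convergence for the single measure `D`: the indicators of `U^{ε_k}`
converge pointwise to that of `U`. -/

namespace DivMeasure

/-! ### Riesz representation of bounded functionals by signed measures. -/

section Riesz

open scoped BoundedContinuousFunction NNReal CompactlySupported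

variable {X : Type*} [TopologicalSpace X]

/-- The positive part of a continuous linear functional on bounded continuous functions,
evaluated at a nonnegative function. -/
noncomputable def functionalPosPart (Λ : (X →ᵇ ℝ) →L[ℝ] ℝ) (f : X →ᵇ ℝ) : ℝ :=
  sSup (Λ '' Icc 0 f)

theorem norm_le_of_mem_Icc {f g : X →ᵇ ℝ} (hg : g ∈ Icc 0 f) : ‖g‖ ≤ ‖f‖ := by
  refine (BoundedContinuousFunction.norm_le (norm_nonneg _)).2 fun x => ?_
  have h0 : 0 ≤ g x := hg.1 x
  have h1 : g x ≤ f x := hg.2 x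
  rw [Real.norm_of_nonneg h0]
  exact h1.trans ((le_abs_self _).trans (f.norm_coe_le_norm x))

theorem le_functionalPosPart (Λ : (X →ᵇ ℝ) →L[ℝ] ℝ) {f g : X →ᵇ ℝ} (hg : g ∈ Icc 0 f) :
    Λ g ≤ functionalPosPart Λ f := by
  refine le_csSup ⟨‖Λ‖ * ‖f‖, ?_⟩ (mem_image_of_mem _ hg)
  rintro _ ⟨g, hg, rfl⟩
  refine (le_abs_self _).trans ((Λ.le_opNorm g).trans ?_)
  gcongr
  exact norm_le_of_mem_Icc hg

theorem functionalPosPart_le (Λ : (X →ᵇ ℝ) →L[ℝ] ℝ) {f : X →ᵇ ℝ} (hf : 0 ≤ f) {c : ℝ}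
    (h : ∀ g ∈ Icc 0 f, Λ g ≤ c) : functionalPosPart Λ f ≤ c := by
  refine csSup_le ⟨_, mem_image_of_mem _ (left_mem_Icc.2 hf)⟩ ?_
  rintro _ ⟨g, hg, rfl⟩
  exact h g hg

theorem functionalPosPart_nonneg (Λ : (X →ᵇ ℝ) →L[ℝ] ℝ) {f : X →ᵇ ℝ} (hf : 0 ≤ f) :
    0 ≤ functionalPosPart Λ f := by
  simpa using le_functionalPosPart Λ (left_mem_Icc.2 hf)

theorem functionalPosPart_le_norm (Λ : (X →ᵇ ℝ) →L[ℝ] ℝ) {f : X →ᵇ ℝ} (hf : 0 ≤ f) :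
    functionalPosPart Λ f ≤ ‖Λ‖ * ‖f‖ := by
  refine functionalPosPart_le Λ hf fun g hg => ?_
  refine (le_abs_self _).trans ((Λ.le_opNorm g).trans ?_)
  gcongr
  exact norm_le_of_mem_Icc hg

/-- Riesz decomposition: any `g` in `[0, f₁ + f₂]` splits as `g ⊓ f₁` in `[0, f₁]` plus a remainder
in `[0, f₂]`. The other inequality adds competitors. -/
theorem functionalPosPart_add (Λ : (X →ᵇ ℝ) →L[ℝ] ℝ) {f₁ f₂ : X →ᵇ ℝ} (h₁ : 0 ≤ f₁)
    (h₂ : 0 ≤ f₂) :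
    functionalPosPart Λ (f₁ + f₂) = functionalPosPart Λ f₁ + functionalPosPart Λ f₂ := by
  apply le_antisymm
  · refine functionalPosPart_le Λ (add_nonneg h₁ h₂) fun g hg => ?_
    have e : Λ g = Λ (g ⊓ f₁) + Λ (g - g ⊓ f₁) := by rw [← map_add]; congr 1; abel
    rw [e]
    refine add_le_add (le_functionalPosPart Λ ⟨le_inf hg.1 h₁, inf_le_right⟩)
      (le_functionalPosPart Λ ⟨sub_nonneg.2 inf_le_left, fun x => ?_⟩)
    have h3 : g x ≤ f₁ x + f₂ x := hg.2 x
    have h4 : 0 ≤ f₂ x := h₂ x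
    change g x - min (g x) (f₁ x) ≤ f₂ x
    rcases le_total (g x) (f₁ x) with h | h <;> simp [h] <;> linarith
  · rw [← le_sub_iff_add_le]
    refine functionalPosPart_le Λ h₁ fun g₁ hg₁ => ?_
    rw [le_sub_iff_add_le, ← le_sub_iff_add_le']
    refine functionalPosPart_le Λ h₂ fun g₂ hg₂ => ?_
    rw [le_sub_iff_add_le', ← map_add]
    exact le_functionalPosPart Λ ⟨add_nonneg hg₁.1 hg₂.1, add_le_add hg₁.2 hg₂.2⟩

theorem functionalPosPart_smul (Λ : (X →ᵇ ℝ) →L[ℝ] ℝ) {f : X →ᵇ ℝ} (hf : 0 ≤ f) {c : ℝ}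
    (hc : 0 ≤ c) : functionalPosPart Λ (c • f) = c * functionalPosPart Λ f := by
  have key : ∀ {c : ℝ} {f : X →ᵇ ℝ}, 0 ≤ f → 0 < c →
      c * functionalPosPart Λ f ≤ functionalPosPart Λ (c • f) := by
    intro c f hf hc
    rw [← le_div_iff₀' hc]
    refine functionalPosPart_le Λ hf fun g hg => ?_
    rw [le_div_iff₀' hc, ← smul_eq_mul, ← map_smul]
    refine le_functionalPosPart Λ ⟨fun x => mul_nonneg hc.le (hg.1 x), fun x => ?_⟩
    exact mul_le_mul_of_nonneg_left (hg.2 x) hc.le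
  rcases hc.eq_or_lt with rfl | hc
  · rw [zero_smul, zero_mul]
    refine le_antisymm ?_ (functionalPosPart_nonneg Λ le_rfl)
    simpa using functionalPosPart_le_norm Λ (le_refl (0 : X →ᵇ ℝ))
  refine le_antisymm ?_ (key hf hc)
  have h := key (c := c⁻¹) (f := c • f) (fun x => mul_nonneg hc.le (hf x)) (inv_pos.2 hc)
  rw [smul_smul, inv_mul_cancel₀ hc.ne', one_smul, inv_mul_le_iff₀ hc] at h
  exact h

/-- The reflection `g ↦ f - g` maps `[0, f]` to itself and turns competitors for `Λ` into
competitors for `-Λ`. This is the Jordan decomposition of `Λ`. -/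
theorem functionalPosPart_sub_neg (Λ : (X →ᵇ ℝ) →L[ℝ] ℝ) {f : X →ᵇ ℝ} (hf : 0 ≤ f) :
    functionalPosPart Λ f - functionalPosPart (-Λ) f = Λ f := by
  have key : ∀ Λ : (X →ᵇ ℝ) →L[ℝ] ℝ, functionalPosPart Λ f ≤ Λ f + functionalPosPart (-Λ) f := by
    intro Λ
    refine functionalPosPart_le Λ hf fun g hg => ?_
    have := le_functionalPosPart (-Λ) (f := f) (g := f - g)
      ⟨sub_nonneg.2 hg.2, sub_le_self _ hg.1⟩
    simp only [neg_apply, map_sub] at this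
    linarith
  have h1 := key Λ
  have h2 := key (-Λ)
  have h3 : - -Λ = Λ := by ext; simp
  rw [h3, neg_apply] at h2
  linarith

/-- A compactly supported continuous function as a bounded continuous function. -/
noncomputable def toBounded (f : C_c(X, ℝ)) : X →ᵇ ℝ :=
  BoundedContinuousFunction.ofNormedAddCommGroup f f.continuous _
    (f.hasCompactSupport.exists_bound_of_continuous f.continuous).choose_spec

@[simp]
theorem toBounded_apply (f : C_c(X, ℝ)) (x : X) : toBounded f x = f x := rfl

theorem toBounded_toReal_nonneg (f : C_c(X, ℝ≥0)) : 0 ≤ toBounded f.toReal := by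
  intro x
  change 0 ≤ toBounded f.toReal x
  simp

/-- The positive part of a functional, as an `ℝ≥0`-linear functional. -/
noncomputable def posPartLinear (Λ : (X →ᵇ ℝ) →L[ℝ] ℝ) : C_c(X, ℝ≥0) →ₗ[ℝ≥0] ℝ≥0 where
  toFun f := ⟨functionalPosPart Λ (toBounded f.toReal),
    functionalPosPart_nonneg Λ (toBounded_toReal_nonneg f)⟩
  map_add' f g := by
    apply NNReal.eq
    have : toBounded (f + g).toReal = toBounded f.toReal + toBounded g.toReal := by
      ext x; simp
    simp only [this]
    exact functionalPosPart_add Λ (toBounded_toReal_nonneg f) (toBounded_toReal_nonneg g)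
  map_smul' c f := by
    apply NNReal.eq
    have : toBounded (c • f).toReal = (c : ℝ) • toBounded f.toReal := by
      ext x; simp [NNReal.smul_def]
    simp only [this]
    exact functionalPosPart_smul Λ (toBounded_toReal_nonneg f) c.2

theorem coe_posPartLinear (Λ : (X →ᵇ ℝ) →L[ℝ] ℝ) (f : C_c(X, ℝ≥0)) :
    (posPartLinear Λ f : ℝ) = functionalPosPart Λ (toBounded f.toReal) := rfl

variable [T2Space X] [LocallyCompactSpace X] [MeasurableSpace X] [BorelSpace X]

/-- The measure representing the positive part of a functional. -/
noncomputable def posPartMeasure (Λ : (X →ᵇ ℝ) →L[ℝ] ℝ) : Measure X :=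
  RealRMK.rieszMeasure (CompactlySupportedContinuousMap.toRealPositiveLinear (posPartLinear Λ))

theorem integral_posPartMeasure (Λ : (X →ᵇ ℝ) →L[ℝ] ℝ) (f : C_c(X, ℝ)) :
    ∫ x, f x ∂(posPartMeasure Λ) = functionalPosPart Λ (toBounded f.nnrealPart.toReal) -
      functionalPosPart Λ (toBounded (-f).nnrealPart.toReal) := by
  rw [posPartMeasure, RealRMK.integral_rieszMeasure,
    CompactlySupportedContinuousMap.toRealPositiveLinear_apply, coe_posPartLinear,
    coe_posPartLinear]

/-- A cutoff with values in `[0, 1]` that equals `1` on `K` dominates the mass of `K`, and the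
functional is at most `‖Λ‖` on it. Uniformity in `K` makes the measure finite on a σ-compact space.
-/
theorem posPartMeasure_le_of_isCompact (Λ : (X →ᵇ ℝ) →L[ℝ] ℝ) {K : Set X} (hK : IsCompact K) :
    posPartMeasure Λ K ≤ ENNReal.ofReal ‖Λ‖ := by
  obtain ⟨f, hf1, -, hfc, hf01⟩ := exists_continuous_one_zero_of_isCompact hK isClosed_empty
    (disjoint_empty K)
  let g : C_c(X, ℝ) := ⟨f, hfc⟩
  have hg0 : (0 : C_c(X, ℝ)) ≤ g := fun x => (hf01 x).1
  refine (RealRMK.rieszMeasure_le_of_eq_one _ (f := g) (fun x => (hf01 x).1) hK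
    fun x hx => hf1 hx).trans (ENNReal.ofReal_le_ofReal ?_)
  rw [CompactlySupportedContinuousMap.toRealPositiveLinear_apply,
    CompactlySupportedContinuousMap.nnrealPart_neg_eq_zero_of_nonneg hg0, map_zero,
    NNReal.coe_zero, sub_zero, coe_posPartLinear]
  refine (functionalPosPart_le_norm Λ (toBounded_toReal_nonneg _)).trans
    (mul_le_of_le_one_right (by positivity) ?_)
  refine (BoundedContinuousFunction.norm_le zero_le_one).2 fun x => ?_
  have : toBounded g.nnrealPart.toReal x = f x := by
    simp only [toBounded_apply, CompactlySupportedContinuousMap.toReal_apply,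
      CompactlySupportedContinuousMap.nnrealPart_apply]
    exact Real.coe_toNNReal _ (hf01 x).1
  rw [this, Real.norm_of_nonneg (hf01 x).1]
  exact (hf01 x).2

instance [SigmaCompactSpace X] (Λ : (X →ᵇ ℝ) →L[ℝ] ℝ) : IsFiniteMeasure (posPartMeasure Λ) where
  measure_univ_lt_top := by
    rw [← iUnion_compactCovering X,
      Monotone.measure_iUnion (fun m n h => compactCovering_subset X h)]
    exact (iSup_le fun n => posPartMeasure_le_of_isCompact Λ
      (isCompact_compactCovering X n)).trans_lt ENNReal.ofReal_lt_top

/-- A continuous linear functional on bounded continuous functions is represented, on compactly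
supported functions, by a signed measure. -/
theorem exists_signedMeasure_integral_eq [SigmaCompactSpace X] (Λ : (X →ᵇ ℝ) →L[ℝ] ℝ) :
    ∃ μ : SignedMeasure X, ∀ f : X →ᵇ ℝ, HasCompactSupport f → ∫ᵛ x, f x ∂•μ = Λ f := by
  refine ⟨(posPartMeasure Λ).toSignedMeasure - (posPartMeasure (-Λ)).toSignedMeasure,
    fun f hf => ?_⟩
  have flip_eq : (ContinuousLinearMap.lsmul ℝ ℝ : ℝ →L[ℝ] ℝ →L[ℝ] ℝ) =
      (ContinuousLinearMap.lsmul ℝ ℝ : ℝ →L[ℝ] ℝ →L[ℝ] ℝ).flip := by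
    ext; simp
  have hint : ∀ m : Measure X, IsFiniteMeasure m → Integrable f m := fun m _ => by
    have : IsFiniteMeasureOnCompacts m := inferInstance
    exact f.continuous.integrable_of_hasCompactSupport hf
  let g : C_c(X, ℝ) := ⟨f.toContinuousMap, hf⟩
  have hpos : ∀ Λ : (X →ᵇ ℝ) →L[ℝ] ℝ, ∫ᵛ x, f x ∂•(posPartMeasure Λ).toSignedMeasure =
      functionalPosPart Λ (toBounded g.nnrealPart.toReal) -
      functionalPosPart Λ (toBounded (-g).nnrealPart.toReal) := fun Λ => by
    rw [← integral_posPartMeasure, flip_eq, VectorMeasure.integral_toSignedMeasure]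
    rfl
  rw [VectorMeasure.integral_sub_vectorMeasure
    (by simpa [VectorMeasure.Integrable] using hint _ inferInstance)
    (by simpa [VectorMeasure.Integrable] using hint _ inferInstance), hpos, hpos]
  have e1 := functionalPosPart_sub_neg Λ (toBounded_toReal_nonneg g.nnrealPart)
  have e2 := functionalPosPart_sub_neg Λ (toBounded_toReal_nonneg (-g).nnrealPart)
  have e3 : f = toBounded g.nnrealPart.toReal - toBounded (-g).nnrealPart.toReal := by
    ext x
    exact (DFunLike.congr_fun
      (CompactlySupportedContinuousMap.nnrealPart_sub_nnrealPart_neg g) x).symm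
  have e4 : Λ f = Λ (toBounded g.nnrealPart.toReal) - Λ (toBounded (-g).nnrealPart.toReal) := by
    rw [← map_sub, ← e3]
  linarith

/-- Riesz representation for a linear functional that is bounded with respect to the supremum
norm of the image under a linear map into compactly supported functions. -/
theorem exists_signedMeasure_of_bound [SigmaCompactSpace X] {V : Type*} [AddCommGroup V]
    [Module ℝ V] (ι : V →ₗ[ℝ] (X →ᵇ ℝ)) (hι : ∀ v, HasCompactSupport (ι v)) (T : V →ₗ[ℝ] ℝ) {C : ℝ}
    (hT : ∀ v, |T v| ≤ C * ‖ι v‖) :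
    ∃ μ : SignedMeasure X, ∀ v, ∫ᵛ x, ι v x ∂•μ = T v := by
  -- `ι` need not be injective (different `φ` may agree on `∂U^ε`), but the bound makes `T` descend
  -- to the range of `ι`; Hahn-Banach then extends it.
  have hker : LinearMap.ker ι ≤ LinearMap.ker T := fun v hv => by
    have := hT v
    rw [LinearMap.mem_ker.1 hv, norm_zero, mul_zero] at this
    exact LinearMap.mem_ker.2 (abs_nonpos_iff.1 this)
  let S : LinearMap.range ι →ₗ[ℝ] ℝ :=
    ((LinearMap.ker ι).liftQ T hker).comp ι.quotKerEquivRange.symm.toLinearMap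
  have hS : ∀ v, S ⟨ι v, v, rfl⟩ = T v := fun v => by
    have : ι.quotKerEquivRange.symm ⟨ι v, v, rfl⟩ = (LinearMap.ker ι).mkQ v := by
      rw [LinearEquiv.symm_apply_eq]; rfl
    change (LinearMap.ker ι).liftQ T hker (ι.quotKerEquivRange.symm ⟨ι v, v, rfl⟩) = T v
    rw [this]; rfl
  obtain ⟨Λ, hΛ, -⟩ := exists_extension_norm_eq (𝕜 := ℝ) (LinearMap.range ι)
    (S.mkContinuous C (by rintro ⟨_, v, rfl⟩; rw [hS]; exact hT v))
  obtain ⟨μ, hμ⟩ := exists_signedMeasure_integral_eq Λ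
  exact ⟨μ, fun v => by rw [hμ _ (hι v), ← hS v]; exact hΛ ⟨ι v, v, rfl⟩⟩

end Riesz

end DivMeasure

namespace DivMeasure

/-! ### Scalar densities and integrals against vector measures. -/

section VectorIntegral

variable {X E G H : Type*} {mX : MeasurableSpace X}
  [NormedAddCommGroup E] [NormedSpace ℝ E] [NormedAddCommGroup G] [NormedSpace ℝ G]
  [NormedAddCommGroup H] [NormedSpace ℝ H]

/-- Integrals with respect to a vector measure depend continuously on the integrand in `L¹(ν)`,
for every measure `ν` that dominates a multiple of the variation. -/
theorem continuous_integral_Lp_of_le {μ : VectorMeasure X G} (B : E →L[ℝ] G →L[ℝ] H)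
    {ν : Measure X} {c : ℝ≥0∞} (hc : c ≠ ⊤) (h : μ.variation ≤ c • ν) :
    Continuous fun f : X →₁[ν] E => ∫ᵛ x, f x ∂[B; μ] := by
  have hint : ∀ f : X →₁[ν] E, Integrable f μ.variation := fun f =>
    ((L1.integrable_coeFn f).smul_measure hc).mono_measure h
  rw [continuous_iff_continuousAt]
  intro f
  refine VectorMeasure.tendsto_integral_of_L1 f (hint f).1 (Eventually.of_forall hint) ?_
  have h0 : Tendsto (fun g : X →₁[ν] E => c * edist g f) (𝓝 f) (𝓝 0) := by
    have : Tendsto (fun g : X →₁[ν] E => edist g f) (𝓝 f) (𝓝 0) :=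
      tendsto_iff_edist_tendsto_0.1 tendsto_id
    simpa using ENNReal.Tendsto.const_mul this (Or.inr hc)
  refine tendsto_of_tendsto_of_tendsto_of_le_of_le tendsto_const_nhds h0
    (fun _ => zero_le) fun g => ?_
  refine (lintegral_mono' h le_rfl).trans ?_
  rw [lintegral_smul_measure, Lp.edist_def, eLpNorm_one_eq_lintegral_enorm]
  rfl

theorem variation_withDensity_le_smul (μ : VectorMeasure X G) {φ : X → ℝ} {M : ℝ}
    (hM : ∀ᵐ x ∂μ.variation, |φ x| ≤ M) :
    (μ.withDensity φ (ContinuousLinearMap.lsmul ℝ ℝ)).variation ≤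
      ENNReal.ofReal M • μ.variation := by
  refine VectorMeasure.variation_WithDensity_le.trans ?_
  rw [VectorMeasure.variation_transpose_lsmul, ← withDensity_const]
  refine withDensity_mono (hM.mono fun x hx => ?_)
  change ‖φ x‖ₑ ≤ ENNReal.ofReal M
  rw [Real.enorm_eq_ofReal_abs]
  exact ENNReal.ofReal_le_ofReal hx

variable [CompleteSpace H] [CompleteSpace G]

/-- Pairing a constant with the integral of a scalar function. -/
theorem apply_integral_eq_integral_smul (μ : VectorMeasure X G) [IsFiniteMeasure μ.variation]
    (B : E →L[ℝ] G →L[ℝ] H) {φ : X → ℝ} (hφ : Integrable φ μ.variation) (c : E) :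
    B c (∫ᵛ x, φ x ∂•μ) = ∫ᵛ x, φ x • c ∂[B; μ] := by
  refine Integrable.induction (fun φ : X → ℝ => B c (∫ᵛ x, φ x ∂•μ) = ∫ᵛ x, φ x • c ∂[B; μ])
    (fun a s hs hμ => ?_) (fun f g _ hf hg hf' hg' => ?_) ?_ (fun f g hfg _ h => ?_) hφ
  · have e : (fun x => s.indicator (fun _ => a) x • c) = s.indicator fun _ => a • c := by
      ext x; by_cases hx : x ∈ s <;> simp [hx]
    rw [e, VectorMeasure.integral_indicator hs, VectorMeasure.integral_indicator hs,
      VectorMeasure.integral_const, VectorMeasure.integral_const]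
    simp
  · rw [VectorMeasure.integral_add hf hg, map_add, hf', hg', ← VectorMeasure.integral_fun_add
      (hf.smul_const c) (hg.smul_const c)]
    simp only [Pi.add_apply, add_smul]
  · refine isClosed_eq ((B c).continuous.comp
      (continuous_integral_Lp_of_le _ ENNReal.one_ne_top (by simp))) ?_
    -- Multiplication by the fixed vector `c` is continuous from scalar `L¹` to `L¹` with values in
    -- `E`, so the right-hand side is continuous in `f`.
    let L : ℝ →L[ℝ] E := ContinuousLinearMap.toSpanSingleton ℝ c
    have : ∀ f : X →₁[μ.variation] ℝ, ∫ᵛ x, f x • c ∂[B; μ] = ∫ᵛ x, L.compLp f x ∂[B; μ] :=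
      fun f => VectorMeasure.integral_congr_ae ((L.coeFn_compLp f).mono fun x hx => by
        rw [hx]; simp [L])
    simp_rw [this]
    exact (continuous_integral_Lp_of_le (μ := μ) B ENNReal.one_ne_top (by simp)).comp
      (ContinuousLinearMap.compLpL 1 μ.variation L).continuous
  · rw [← VectorMeasure.integral_congr_ae hfg, h]
    exact VectorMeasure.integral_congr_ae (hfg.mono fun x hx => by simp [hx])

/-- Integration against a vector measure with a bounded scalar density. -/
theorem integral_withDensity_lsmul (μ : VectorMeasure X G) [IsFiniteMeasure μ.variation]
    (B : E →L[ℝ] G →L[ℝ] H) {φ : X → ℝ} (hφ : AEStronglyMeasurable φ μ.variation) {M : ℝ}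
    (hM : ∀ᵐ x ∂μ.variation, |φ x| ≤ M) {g : X → E} (hg : Integrable g μ.variation) :
    ∫ᵛ x, g x ∂[B; μ.withDensity φ (ContinuousLinearMap.lsmul ℝ ℝ)] =
      ∫ᵛ x, φ x • g x ∂[B; μ] := by
  have hφi : Integrable φ μ.variation := Integrable.of_bound hφ M hM
  have hle := variation_withDensity_le_smul μ hM
  have hfin : IsFiniteMeasure (μ.withDensity φ (ContinuousLinearMap.lsmul ℝ ℝ)).variation :=
    isFiniteMeasure_of_le (M.toNNReal • μ.variation) hle
  have hac : (μ.withDensity φ (ContinuousLinearMap.lsmul ℝ ℝ)).variation ≪ μ.variation :=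
    Measure.absolutelyContinuous_of_le_smul hle
  have hmul : ∀ {f : X → E}, Integrable f μ.variation →
      Integrable (fun x => φ x • f x) μ.variation := fun hf => hf.bdd_smul M hφ hM
  refine Integrable.induction (fun g : X → E =>
      ∫ᵛ x, g x ∂[B; μ.withDensity φ (ContinuousLinearMap.lsmul ℝ ℝ)] = ∫ᵛ x, φ x • g x ∂[B; μ])
    (fun a s hs hμ => ?_) (fun f g _ hf hg hf' hg' => ?_) ?_ (fun f g hfg _ h => ?_) hg
  · have e : (fun x => φ x • s.indicator (fun _ => a) x) = s.indicator fun x => φ x • a := by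
      ext x; by_cases hx : x ∈ s <;> simp [hx]
    have hr : (μ.restrict s).variation ≤ μ.variation :=
      VectorMeasure.variation_restrict_le.trans Measure.restrict_le_self
    -- On an indicator of `s` the claim is the constant-vector case above, for the restriction of
    -- `μ` to `s`.
    rw [e, VectorMeasure.integral_indicator hs, VectorMeasure.integral_indicator hs,
      VectorMeasure.integral_const, VectorMeasure.restrict_apply _ hs MeasurableSet.univ,
      univ_inter, VectorMeasure.withDensity_apply hφi,
      apply_integral_eq_integral_smul _ B (hφi.mono_measure hr)]
  · have hf1 := (hf.smul_measure ENNReal.ofReal_ne_top).mono_measure hle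
    have hg1 := (hg.smul_measure ENNReal.ofReal_ne_top).mono_measure hle
    rw [VectorMeasure.integral_add hf1 hg1, hf', hg', ← VectorMeasure.integral_fun_add
      (hmul hf) (hmul hg)]
    simp only [Pi.add_apply, smul_add]
  · refine isClosed_eq (continuous_integral_Lp_of_le _ ENNReal.ofReal_ne_top hle) ?_
    rw [Metric.continuous_iff]
    intro f ε hε
    -- `‖B‖ * |M|` is a Lipschitz constant for the right-hand side; the `+ 1` only avoids division
    -- by zero.
    refine ⟨ε / (‖B‖ * |M| + 1), by positivity, fun g hgf => ?_⟩
    have hi : ∀ f : X →₁[μ.variation] E, Integrable (fun x => φ x • f x) μ.variation :=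
      fun f => hmul (L1.integrable_coeFn f)
    rw [dist_eq_norm, ← VectorMeasure.integral_fun_sub (hi g) (hi f)]
    refine (VectorMeasure.norm_integral_le_integral_norm).trans_lt ?_
    have h1 : ∫ x, ‖φ x • g x - φ x • f x‖ ∂μ.variation ≤ |M| * dist g f := by
      rw [L1.dist_eq_integral_dist, ← integral_const_mul]
      refine integral_mono_ae ((hi g).sub (hi f)).norm ?_ (hM.mono fun x hx => ?_)
      · simp only [dist_eq_norm]
        exact (((L1.integrable_coeFn g).sub (L1.integrable_coeFn f)).norm).const_mul _
      · simp only [← smul_sub, norm_smul, Real.norm_eq_abs, dist_eq_norm]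
        exact mul_le_mul_of_nonneg_right (hx.trans (le_abs_self M)) (norm_nonneg _)
    calc ‖B‖ * ∫ x, ‖φ x • g x - φ x • f x‖ ∂μ.variation
        ≤ ‖B‖ * (|M| * dist g f) := by gcongr
      _ ≤ (‖B‖ * |M| + 1) * dist g f := by
        rw [← mul_assoc]; gcongr; linarith
      _ < ε := by rwa [← lt_div_iff₀' (by positivity)]
  · rw [← VectorMeasure.integral_congr_ae (hac.ae_le hfg), h]
    exact VectorMeasure.integral_congr_ae (hfg.mono fun x hx => by simp [hx])

instance (μ : SignedMeasure X) : IsFiniteMeasure μ.variation := by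
  rw [← SignedMeasure.totalVariation_eq_variation]
  unfold SignedMeasure.totalVariation
  infer_instance

theorem integral_indicator_one_signedMeasure (μ : SignedMeasure X) {s : Set X}
    (hs : MeasurableSet s) : ∫ᵛ x, s.indicator 1 x ∂•μ = μ s := by
  rw [VectorMeasure.integral_indicator hs]
  simp

end VectorIntegral

end DivMeasure

namespace DivMeasure

open ContinuousLinearMap (lsmul)
open Metric (closedBall)

/-! ### Gradients and mollification. -/

section Gradient

variable {E : Type*} [NormedAddCommGroup E] [InnerProductSpace ℝ E] [CompleteSpace E]

theorem norm_gradient (f : E → ℝ) (x : E) : ‖∇ f x‖ = ‖fderiv ℝ f x‖ :=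
  (InnerProductSpace.toDual ℝ E).symm.norm_map _

theorem gradient_mul {f g : E → ℝ} {x : E} (hf : DifferentiableAt ℝ f x)
    (hg : DifferentiableAt ℝ g x) :
    ∇ (fun y => f y * g y) x = f x • ∇ g x + g x • ∇ f x := by
  simp [gradient, fderiv_fun_mul hf hg]

theorem gradient_comp {h : ℝ → ℝ} {f : E → ℝ} {x : E} (hh : DifferentiableAt ℝ h (f x))
    (hf : DifferentiableAt ℝ f x) :
    ∇ (fun y => h (f y)) x = deriv h (f x) • ∇ f x := by
  have e : (fun y => h (f y)) = h ∘ f := rfl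
  rw [gradient, e, (hh.hasDerivAt.comp_hasFDerivAt x hf.hasFDerivAt).fderiv, gradient, map_smul]

theorem gradient_const_mul {f : E → ℝ} {x : E} (c : ℝ) (hf : DifferentiableAt ℝ f x) :
    ∇ (fun y => c * f y) x = c • ∇ f x := by
  simp [gradient, fderiv_const_mul hf]

theorem gradient_add {f g : E → ℝ} {x : E} (hf : DifferentiableAt ℝ f x)
    (hg : DifferentiableAt ℝ g x) :
    ∇ (fun y => f y + g y) x = ∇ f x + ∇ g x := by
  simp [gradient, fderiv_fun_add hf hg]

theorem continuous_gradient {f : E → ℝ} (hf : ContDiff ℝ 1 f) : Continuous (∇ f) :=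
  (InnerProductSpace.toDual ℝ E).symm.continuous.comp (hf.continuous_fderiv one_ne_zero)

theorem hasCompactSupport_gradient {f : E → ℝ} (hf : HasCompactSupport f) :
    HasCompactSupport (∇ f) :=
  (hf.fderiv ℝ).comp_left (map_zero (InnerProductSpace.toDual ℝ E).symm)

end Gradient

section Mollify

variable {n : ℕ}

/-- A sequence of bump functions with supports shrinking to the origin. -/
noncomputable def mollifier (n k : ℕ) : ContDiffBump (0 : EuclideanSpace ℝ (Fin n)) where
  rIn := 1 / ((k : ℝ) + 1) / 2
  rOut := 1 / ((k : ℝ) + 1)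
  rIn_pos := by positivity
  rIn_lt_rOut := half_lt_self (by positivity)

theorem mollifier_rOut (n k : ℕ) : (mollifier n k).rOut = 1 / ((k : ℝ) + 1) := rfl

/-- The convolution of a function with a smooth bump function of radius `1 / (k + 1)`. -/
noncomputable def mollify (f : EuclideanSpace ℝ (Fin n) → ℝ) (k : ℕ) :
    EuclideanSpace ℝ (Fin n) → ℝ :=
  MeasureTheory.convolution ((mollifier n k).normed volume) f (lsmul ℝ ℝ) volume

theorem contDiff_normed_mollifier (k : ℕ) {m : ℕ∞} :
    ContDiff ℝ m ((mollifier n k).normed volume) := (mollifier n k).contDiff_normed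

theorem contDiff_mollify {f : EuclideanSpace ℝ (Fin n) → ℝ} (hf : LocallyIntegrable f) (k : ℕ) :
    ContDiff ℝ ∞ (mollify f k) :=
  (mollifier n k).hasCompactSupport_normed.contDiff_convolution_left _
    (contDiff_normed_mollifier k) hf

theorem tendsto_mollify {f : EuclideanSpace ℝ (Fin n) → ℝ} (hf : AEStronglyMeasurable f)
    {x : EuclideanSpace ℝ (Fin n)} (hx : ContinuousAt f x) :
    Tendsto (fun k => mollify f k x) atTop (𝓝 (f x)) := by
  refine ContDiffBump.convolution_tendsto_right (g := fun _ => f) (k := fun _ => x)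
    (φ := mollifier n) ?_ (Eventually.of_forall fun _ => hf) (hx.tendsto.comp tendsto_snd)
    tendsto_const_nhds
  exact tendsto_one_div_add_atTop_nhds_zero_nat

theorem abs_mollify_le {f : EuclideanSpace ℝ (Fin n) → ℝ} (hf : AEStronglyMeasurable f) {M : ℝ}
    (hM : ∀ x, |f x| ≤ M) (k : ℕ) (x : EuclideanSpace ℝ (Fin n)) : |mollify f k x| ≤ M := by
  have := dist_convolution_le (z₀ := (0 : ℝ)) (x₀ := x)
    (f := (mollifier n k).normed volume) (g := f) (μ := volume) ((abs_nonneg _).trans (hM 0))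
    (mollifier n k).support_normed_eq.subset
    (mollifier n k).nonneg_normed (mollifier n k).integral_normed hf
    (fun y _ => by simpa using hM y)
  rwa [dist_zero_right] at this

theorem abs_mollify_sub_le {f : EuclideanSpace ℝ (Fin n) → ℝ} (hf : LipschitzWith 1 f)
    (k : ℕ) (x : EuclideanSpace ℝ (Fin n)) :
    |mollify f k x - f x| ≤ 1 / ((k : ℝ) + 1) := by
  refine (mollifier n k).dist_normed_convolution_le (x₀ := x)
    hf.continuous.aestronglyMeasurable fun y hy => ?_
  have := hf.dist_le_mul y x
  rw [NNReal.coe_one, one_mul] at this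
  exact this.trans (Metric.mem_ball.1 hy).le

theorem lipschitzWith_mollify {f : EuclideanSpace ℝ (Fin n) → ℝ} (hf : LipschitzWith 1 f) (k : ℕ) :
    LipschitzWith 1 (mollify f k) := by
  refine LipschitzWith.of_dist_le_mul fun x y => ?_
  set ρ := (mollifier n k).normed volume
  have hcs : HasCompactSupport ρ := (mollifier n k).hasCompactSupport_normed
  have hρ : Continuous ρ := (mollifier n k).continuous_normed
  have hex : ∀ z : EuclideanSpace ℝ (Fin n), Integrable fun t => ρ t • f (z - t) := fun z =>
    (hρ.smul (hf.continuous.comp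
      (continuous_const.sub continuous_id))).integrable_of_hasCompactSupport hcs.smul_right
  have e : mollify f k x - mollify f k y = ∫ t, ρ t • (f (x - t) - f (y - t)) := by
    simp_rw [smul_sub]
    exact (integral_sub (hex x) (hex y)).symm
  rw [dist_eq_norm, e]
  calc ‖∫ t, ρ t • (f (x - t) - f (y - t))‖ ≤ ∫ t, ρ t * dist x y := by
        refine norm_integral_le_of_norm_le (((mollifier n k).integrable_normed).mul_const _)
          (Eventually.of_forall fun t => ?_)
        rw [norm_smul, Real.norm_of_nonneg ((mollifier n k).nonneg_normed t)]
        refine mul_le_mul_of_nonneg_left ?_ ((mollifier n k).nonneg_normed t)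
        have := hf.dist_le_mul (x - t) (y - t)
        rwa [NNReal.coe_one, one_mul, dist_sub_right, dist_eq_norm] at this
    _ = ((1 : NNReal) : ℝ) * dist x y := by
        rw [integral_mul_const, (mollifier n k).integral_normed, NNReal.coe_one]

/-- The bound holds at every point, not just almost everywhere. This matters because the variation
of `F` may charge Lebesgue-null sets. -/
theorem norm_gradient_mollify_le_one {f : EuclideanSpace ℝ (Fin n) → ℝ} (hf : LipschitzWith 1 f)
    (k : ℕ) (x : EuclideanSpace ℝ (Fin n)) :
    ‖∇ (mollify f k) x‖ ≤ 1 := by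
  rw [norm_gradient]
  exact norm_fderiv_le_of_lipschitz ℝ (lipschitzWith_mollify hf k)

/-- Inside `Ω`, mollification does not increase the bound on a weak gradient. -/
theorem norm_gradient_mollify_le {Ω : Set (EuclideanSpace ℝ (Fin n))} (hΩ : IsOpen Ω)
    {φ : EuclideanSpace ℝ (Fin n) → ℝ}
    (hφ : LocallyIntegrable (Ω.indicator φ))
    {g : EuclideanSpace ℝ (Fin n) → EuclideanSpace ℝ (Fin n)} (hg : IsWeakGradient Ω φ g) {L : ℝ}
    (hL : ∀ᵐ x ∂volume.restrict Ω, ‖g x‖ ≤ L) (hL0 : 0 ≤ L) {k : ℕ} {x : EuclideanSpace ℝ (Fin n)}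
    (hx : closedBall x (1 / ((k : ℝ) + 1)) ⊆ Ω) :
    ‖∇ (mollify (Ω.indicator φ) k) x‖ ≤ L := by
  set ρ := (mollifier n k).normed volume with hρdef
  have hcs : HasCompactSupport ρ := (mollifier n k).hasCompactSupport_normed
  have hρ : ContDiff ℝ ∞ ρ := contDiff_normed_mollifier k
  have hρ1 : ContDiff ℝ 1 ρ := contDiff_normed_mollifier k
  set ψ : EuclideanSpace ℝ (Fin n) → ℝ := fun y => ρ (x - y)
  have hψs : tsupport ψ ⊆ closedBall x (1 / ((k : ℝ) + 1)) := by
    refine closure_minimal (fun y hy => ?_) Metric.isClosed_closedBall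
    have : x - y ∈ Function.support ρ := hy
    rw [hρdef, (mollifier n k).support_normed_eq, mem_ball_zero_iff, mollifier_rOut] at this
    rw [Metric.mem_closedBall, dist_comm, dist_eq_norm]
    exact this.le
  -- The reflected kernel centred at `x` is itself an admissible test function, so the definition of
  -- the weak gradient applies to it.
  have hψ : IsTest ∞ Ω ψ :=
    ⟨hρ.comp (contDiff_const.sub contDiff_id),
      (isCompact_closedBall _ _).of_isClosed_subset (isClosed_tsupport _) hψs, hψs.trans hx⟩
  have hgrad : ∀ y, fderiv ℝ ρ (x - y) = -fderiv ℝ ψ y := fun y => by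
    have h : fderiv ℝ ψ y = _ := ((hρ1.differentiable one_ne_zero (x - y)).hasFDerivAt.comp y
      ((hasFDerivAt_id y).const_sub x)).fderiv
    rw [h]
    ext v
    simp
  have hder := hcs.hasFDerivAt_convolution_left (lsmul ℝ ℝ) hρ1 hφ x
  have e1 : fderiv ℝ (mollify (Ω.indicator φ) k) x =
      -∫ y in Ω, φ y • fderiv ℝ ψ y := by
    rw [show mollify (Ω.indicator φ) k = MeasureTheory.convolution ρ (Ω.indicator φ)
      (lsmul ℝ ℝ) volume from rfl, hder.fderiv, convolution_eq_swap, ← integral_neg,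
      ← integral_indicator hΩ.measurableSet]
    congr 1
    ext y v
    by_cases hy : y ∈ Ω <;> simp [hgrad, hy, mul_comm]
  have e2 : ∇ (mollify (Ω.indicator φ) k) x = -∫ y in Ω, φ y • ∇ ψ y := by
    rw [gradient, e1, map_neg]
    congr 1
    refine ((InnerProductSpace.toDual ℝ
      (EuclideanSpace ℝ (Fin n))).symm.toLinearIsometry.integral_comp_comm _).symm.trans ?_
    simp [gradient]
  rw [e2, hg ψ hψ, neg_neg]
  have hint : Integrable ψ := (mollifier n k).integrable_normed.comp_sub_left x
  calc ‖∫ y in Ω, ψ y • g y‖ ≤ ∫ y in Ω, ψ y * L := by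
        refine norm_integral_le_of_norm_le (hint.integrableOn.mul_const L) (hL.mono fun y hy => ?_)
        rw [norm_smul, Real.norm_of_nonneg ((mollifier n k).nonneg_normed _)]
        exact mul_le_mul_of_nonneg_left hy ((mollifier n k).nonneg_normed _)
    _ = (∫ y in Ω, ψ y) * L := integral_mul_const _ _
    _ ≤ (∫ y, ψ y) * L := by
        refine mul_le_mul_of_nonneg_right (setIntegral_le_integral hint
          (Eventually.of_forall fun y => (mollifier n k).nonneg_normed _)) hL0
    _ = L := by
        rw [show (∫ y, ψ y) = ∫ y, ρ y from integral_sub_left_eq_self ρ volume x,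
          (mollifier n k).integral_normed, one_mul]

end Mollify

end DivMeasure

/-! ### Products of `W^{1,∞}` functions with divergence-measure fields. -/

namespace DivMeasure

open ContinuousLinearMap (lsmul)
open Metric (closedBall)

variable {n : ℕ} {Ω : Set (EuclideanSpace ℝ (Fin n))}
  {F : VectorMeasure (EuclideanSpace ℝ (Fin n)) (EuclideanSpace ℝ (Fin n))}
  {φ ψ : EuclideanSpace ℝ (Fin n) → ℝ}

theorem exists_ae_bound_of_memLp_top {X E : Type*} {mX : MeasurableSpace X} [NormedAddCommGroup E]
    {μ : Measure X} {f : X → E} (hf : MemLp f ⊤ μ) : ∃ M, 0 ≤ M ∧ ∀ᵐ x ∂μ, ‖f x‖ ≤ M := by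
  refine ⟨(eLpNormEssSup f μ).toReal, ENNReal.toReal_nonneg, ?_⟩
  have h : eLpNormEssSup f μ ≠ ⊤ := by simpa using hf.2.ne
  filter_upwards [ae_le_eLpNormEssSup (f := f) (μ := μ)] with x hx
  rw [← toReal_enorm]
  exact ENNReal.toReal_mono h hx

/-- By continuity the set where `|φ| > M` is open in `Ω`; being Lebesgue-null, it is empty. A
pointwise bound is needed because `F` may be singular to Lebesgue measure. -/
theorem MemW1Infty.exists_bound (hΩ : IsOpen Ω) (hφ : MemW1Infty Ω φ) :
    ∃ M, 0 ≤ M ∧ ∀ x ∈ Ω, |φ x| ≤ M := by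
  obtain ⟨M, hM0, hM⟩ := exists_ae_bound_of_memLp_top hφ.memLp
  refine ⟨M, hM0, fun x hx => ?_⟩
  by_contra! hlt
  have hopen : IsOpen (Ω ∩ (fun y => |φ y|) ⁻¹' Ioi M) :=
    hφ.continuousOn.abs.isOpen_inter_preimage hΩ isOpen_Ioi
  have hzero : volume (Ω ∩ (fun y => |φ y|) ⁻¹' Ioi M) = 0 := by
    rw [ae_restrict_iff' hΩ.measurableSet] at hM
    refine measure_mono_null (fun y hy => ?_) (mem_ae_iff.1 hM)
    exact fun h => absurd (h hy.1) (not_le.2 hy.2)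
  exact (hopen.measure_eq_zero_iff volume).1 hzero |>.subset ⟨hx, hlt⟩

theorem MemW1Infty.locallyIntegrable_indicator (hΩ : IsOpen Ω) (hφ : MemW1Infty Ω φ) :
    LocallyIntegrable (Ω.indicator φ) :=
  ((memLp_indicator_iff_restrict hΩ.measurableSet).2 hφ.memLp).locallyIntegrable le_top

theorem IsTest.of_le {k m : WithTop ℕ∞} (h : k ≤ m) (hψ : IsTest m Ω ψ) : IsTest k Ω ψ :=
  ⟨hψ.contDiff.of_le h, hψ.hasCompactSupport, hψ.tsupport_subset⟩

theorem IsTest.one (hψ : IsTest ∞ Ω ψ) : IsTest 1 Ω ψ := hψ.of_le (by exact_mod_cast le_top)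

theorem IsTest.mul_left {u : EuclideanSpace ℝ (Fin n) → ℝ} {k : WithTop ℕ∞} (hu : ContDiff ℝ k u)
    (hψ : IsTest k Ω ψ) : IsTest k Ω fun x => u x * ψ x :=
  ⟨hu.mul hψ.contDiff, hψ.hasCompactSupport.mul_left,
    (tsupport_mul_subset_right).trans hψ.tsupport_subset⟩

theorem IsTest.exists_bound {k : WithTop ℕ∞} (hψ : IsTest k Ω ψ) : ∃ C, ∀ x, |ψ x| ≤ C :=
  hψ.hasCompactSupport.exists_bound_of_continuous hψ.contDiff.continuous

theorem IsTest.exists_gradient_bound (hψ : IsTest 1 Ω ψ) : ∃ C, ∀ x, ‖∇ ψ x‖ ≤ C :=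
  (hasCompactSupport_gradient hψ.hasCompactSupport).exists_bound_of_continuous
    (continuous_gradient hψ.contDiff)

theorem IsTest.differentiable (hψ : IsTest 1 Ω ψ) : Differentiable ℝ ψ :=
  hψ.contDiff.differentiable one_ne_zero

/-- The test functions in `Ω` form a vector space. -/
def testSubmodule (Ω : Set (EuclideanSpace ℝ (Fin n))) :
    Submodule ℝ (EuclideanSpace ℝ (Fin n) → ℝ) where
  carrier := {ψ | IsTest ∞ Ω ψ}
  add_mem' {f g} hf hg := ⟨hf.contDiff.add hg.contDiff,
    hf.hasCompactSupport.add hg.hasCompactSupport,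
    (tsupport_add f g).trans (union_subset hf.tsupport_subset hg.tsupport_subset)⟩
  zero_mem' := ⟨contDiff_const, HasCompactSupport.zero, by simp [tsupport]⟩
  smul_mem' c f hf := IsTest.mul_left (u := fun _ => c) contDiff_const hf

/-- The space `W^{1,∞}(Ω)`. -/
def w1InftySubmodule (Ω : Set (EuclideanSpace ℝ (Fin n))) :
    Submodule ℝ (EuclideanSpace ℝ (Fin n) → ℝ) where
  carrier := {φ | MemW1Infty Ω φ}
  add_mem' {f g} hf hg := by
    obtain ⟨u, hu, hfu⟩ := hf.exists_weakGradient
    obtain ⟨v, hv, hgv⟩ := hg.exists_weakGradient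
    refine ⟨hf.continuousOn.add hg.continuousOn, hf.memLp.add hg.memLp, u + v, hu.add hv,
      fun ψ hψ => ?_⟩
    have hψi : Integrable ψ (volume.restrict Ω) :=
      (hψ.contDiff.continuous.integrable_of_hasCompactSupport hψ.hasCompactSupport).integrableOn
    have hgi : Integrable (∇ ψ) (volume.restrict Ω) :=
      ((continuous_gradient hψ.one.contDiff).integrable_of_hasCompactSupport
        (hasCompactSupport_gradient hψ.hasCompactSupport)).integrableOn
    have h1 : ∀ {h : EuclideanSpace ℝ (Fin n) → ℝ}, MemLp h ⊤ (volume.restrict Ω) →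
        Integrable (fun x => h x • ∇ ψ x) (volume.restrict Ω) := fun {h} hh => by
      obtain ⟨M, -, hM⟩ := exists_ae_bound_of_memLp_top hh
      exact hgi.bdd_smul M hh.1 hM
    have h2 : ∀ {w : EuclideanSpace ℝ (Fin n) → EuclideanSpace ℝ (Fin n)},
        MemLp w ⊤ (volume.restrict Ω) →
        Integrable (fun x => ψ x • w x) (volume.restrict Ω) := fun {w} hw => by
      obtain ⟨M, -, hM⟩ := exists_ae_bound_of_memLp_top hw
      exact hψi.smul_bdd M hw.1 hM
    simp only [Pi.add_apply, add_smul, smul_add]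
    rw [integral_add (h1 hf.memLp) (h1 hg.memLp), integral_add (h2 hu) (h2 hv), hfu ψ hψ, hgv ψ hψ]
    abel
  zero_mem' := ⟨continuousOn_const, MemLp.zero, 0, MemLp.zero, fun ψ _ => by simp⟩
  smul_mem' c f hf := by
    obtain ⟨u, hu, hfu⟩ := hf.exists_weakGradient
    refine ⟨hf.continuousOn.const_smul c, hf.memLp.const_smul c, c • u, hu.const_smul c,
      fun ψ hψ => ?_⟩
    simp only [Pi.smul_apply, smul_assoc, smul_comm _ c, integral_smul, hfu ψ hψ, smul_neg]

section DMExt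

theorem IsDMExt.isFiniteMeasure (hF : IsDMExt Ω F) : IsFiniteMeasure F.variation :=
  ⟨hF.variation_lt_top⟩

theorem IsDMExt.ae_mem (hF : IsDMExt Ω F) : ∀ᵐ x ∂F.variation, x ∈ Ω :=
  mem_ae_iff.2 hF.concentrated

theorem IsDMExt.aestronglyMeasurable (hΩ : IsOpen Ω) (hF : IsDMExt Ω F) (hφ : ContinuousOn φ Ω) :
    AEStronglyMeasurable φ F.variation := by
  rw [← Measure.restrict_eq_self_of_ae_mem hF.ae_mem]
  exact hφ.aestronglyMeasurable hΩ.measurableSet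

theorem norm_integral_innerSL_le
    (f : EuclideanSpace ℝ (Fin n) → EuclideanSpace ℝ (Fin n)) :
    ‖∫ᵛ x, f x ∂[innerSL ℝ; F]‖ ≤ ∫ x, ‖f x‖ ∂F.variation := by
  refine VectorMeasure.norm_integral_le_integral_norm.trans ?_
  refine mul_le_of_le_one_left (integral_nonneg fun _ => norm_nonneg _) ?_
  exact (innerSL ℝ).opNorm_le_bound zero_le_one fun x => by simp

theorem integrable_smul_gradient (hΩ : IsOpen Ω) (hF : IsDMExt Ω F) (hφ : MemW1Infty Ω φ)
    (hψ : IsTest 1 Ω ψ) : Integrable (fun x => φ x • ∇ ψ x) F.variation := by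
  have := hF.isFiniteMeasure
  obtain ⟨M, hM0, hM⟩ := hφ.exists_bound hΩ
  exact ((continuous_gradient hψ.contDiff).integrable_of_hasCompactSupport
    (hasCompactSupport_gradient hψ.hasCompactSupport)).bdd_smul M
    (hF.aestronglyMeasurable hΩ hφ.continuousOn) (hF.ae_mem.mono fun x hx => hM x hx)

theorem gradPairing_mulField (hΩ : IsOpen Ω) (hF : IsDMExt Ω F) (hφ : MemW1Infty Ω φ)
    (hψ : IsTest 1 Ω ψ) :
    gradPairing (mulField φ F) ψ = ∫ᵛ x, φ x • ∇ ψ x ∂[innerSL ℝ; F] := by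
  have := hF.isFiniteMeasure
  obtain ⟨M, hM0, hM⟩ := hφ.exists_bound hΩ
  exact integral_withDensity_lsmul F (innerSL ℝ) (hF.aestronglyMeasurable hΩ hφ.continuousOn)
    (hF.ae_mem.mono fun x hx => hM x hx)
    ((continuous_gradient hψ.contDiff).integrable_of_hasCompactSupport
      (hasCompactSupport_gradient hψ.hasCompactSupport))

theorem gradPairing_const_mul (c : ℝ) (hψ : Differentiable ℝ ψ) :
    gradPairing F (fun x => c * ψ x) = c * gradPairing F ψ := by
  simp only [gradPairing, gradient_const_mul c (hψ _)]
  exact VectorMeasure.integral_fun_smul F (innerSL ℝ) c (∇ ψ)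

/-- Homogeneity: both `ψ / S` and `-ψ / S` compete in the supremum defining `divVariation`. The case
`S = 0` is separate. -/
theorem abs_gradPairing_le (hF : IsDMExt Ω F) (hψ : IsTest 1 Ω ψ) {S : ℝ}
    (hS : ∀ x, |ψ x| ≤ S) : |gradPairing F ψ| ≤ (divVariation Ω F).toReal * S := by
  have hV := hF.divVariation_lt_top.ne
  have hle : ∀ {χ : EuclideanSpace ℝ (Fin n) → ℝ}, IsTest 1 Ω χ → (∀ x, |χ x| ≤ 1) →
      gradPairing F χ ≤ (divVariation Ω F).toReal := fun {χ} hχ h1 => by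
    rw [← ENNReal.ofReal_le_iff_le_toReal hV]
    exact le_iSup_of_le χ (le_iSup_of_le hχ (le_iSup_of_le h1 le_rfl))
  have hS0 : 0 ≤ S := (abs_nonneg _).trans (hS 0)
  have hscale : ∀ c : ℝ, |c| * S ≤ 1 → c * gradPairing F ψ ≤ (divVariation Ω F).toReal :=
    fun c hc => by
      rw [← gradPairing_const_mul c hψ.differentiable]
      refine hle (hψ.mul_left contDiff_const) fun x => ?_
      rw [abs_mul]
      exact (mul_le_mul_of_nonneg_left (hS x) (abs_nonneg c)).trans hc
  rcases hS0.eq_or_lt with rfl | hS0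
  · have : ψ = fun _ => 0 := funext fun x => abs_nonpos_iff.1 (hS x)
    simp [this, gradPairing, gradient]
  have h1 := hscale S⁻¹ (by rw [abs_of_pos (inv_pos.2 hS0), inv_mul_cancel₀ hS0.ne'])
  have h2 := hscale (-S⁻¹) (by rw [abs_neg, abs_of_pos (inv_pos.2 hS0), inv_mul_cancel₀ hS0.ne'])
  rw [inv_mul_le_iff₀ hS0] at h1
  rw [neg_mul, ← mul_neg, inv_mul_le_iff₀ hS0] at h2
  rw [abs_le]
  constructor <;> linarith

/-- The product of a function in `W^{1,∞}(Ω)` and a divergence-measure field has a divergence of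
finite mass. -/
theorem exists_abs_gradPairing_mulField_le (hΩ : IsOpen Ω) (hF : IsDMExt Ω F)
    (hφ : MemW1Infty Ω φ) :
    ∃ C, ∀ ψ, IsTest ∞ Ω ψ → ∀ S, (∀ x, |ψ x| ≤ S) → |gradPairing (mulField φ F) ψ| ≤ C * S := by
  have := hF.isFiniteMeasure
  obtain ⟨M, hM0, hM⟩ := hφ.exists_bound hΩ
  obtain ⟨g, hg, hφg⟩ := hφ.exists_weakGradient
  obtain ⟨L, hL0, hL⟩ := exists_ae_bound_of_memLp_top hg
  -- The two summands bound the two terms of `φ ∇ψ = ∇(φ ψ) - ψ ∇φ`.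
  refine ⟨(divVariation Ω F).toReal * M + L * F.variation.real univ, fun ψ hψ S hS => ?_⟩
  have hS0 : 0 ≤ S := (abs_nonneg _).trans (hS 0)
  rw [gradPairing_mulField hΩ hF hφ hψ.one]
  set u := fun k => mollify (Ω.indicator φ) k
  have hloc := hφ.locallyIntegrable_indicator hΩ
  have hu : ∀ k, ContDiff ℝ ∞ (u k) := contDiff_mollify hloc
  have hu1 : ∀ k, ContDiff ℝ 1 (u k) := fun k => (hu k).of_le (by exact_mod_cast le_top)
  have huM : ∀ k x, |u k x| ≤ M := fun k x =>
    abs_mollify_le hloc.aestronglyMeasurable (fun y => by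
      by_cases hy : y ∈ Ω
      · simpa [hy] using hM y hy
      · simpa [hy] using hM0) k x
  have hulim : ∀ x ∈ Ω, Tendsto (fun k => u k x) atTop (𝓝 (φ x)) := fun x hx => by
    have hc : ContinuousAt (Ω.indicator φ) x :=
      (hφ.continuousOn.continuousAt (hΩ.mem_nhds hx)).congr
        ((hΩ.eventually_mem hx).mono fun y hy => (indicator_of_mem hy φ).symm)
    simpa [hx] using tendsto_mollify hloc.aestronglyMeasurable hc
  obtain ⟨G, hG⟩ := hψ.one.exists_gradient_bound
  have hlim : Tendsto (fun k => ∫ᵛ x, u k x • ∇ ψ x ∂[innerSL ℝ; F]) atTop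
      (𝓝 (∫ᵛ x, φ x • ∇ ψ x ∂[innerSL ℝ; F])) := by
    refine VectorMeasure.tendsto_integral_of_dominated_convergence (fun _ => M * G)
      (fun k => ((hu k).continuous.smul
        (continuous_gradient hψ.one.contDiff)).aestronglyMeasurable)
      (integrable_const _) (fun k => Eventually.of_forall fun x => ?_)
      (hF.ae_mem.mono fun x hx => (hulim x hx).smul_const _)
    rw [norm_smul]
    exact mul_le_mul (huM k x) (hG x) (norm_nonneg _) hM0
  refine le_of_tendsto hlim.abs ?_
  -- The mollified gradient is bounded by `L` only where the mollification ball stays in `Ω`. This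
  -- holds on the support of `ψ` once the radius is below `δ`.
  obtain ⟨δ, hδ, hsub⟩ := hψ.hasCompactSupport.isCompact.exists_cthickening_subset_open hΩ
    hψ.tsupport_subset
  have hsmall : ∀ᶠ k : ℕ in atTop, 1 / ((k : ℝ) + 1) < δ :=
    tendsto_one_div_add_atTop_nhds_zero_nat.eventually (gt_mem_nhds hδ)
  filter_upwards [hsmall] with k hk
  have hgu : ∀ x ∈ tsupport ψ, ‖∇ (u k) x‖ ≤ L := fun x hx =>
    norm_gradient_mollify_le hΩ hloc hφg hL hL0 ((Metric.closedBall_subset_closedBall hk.le).trans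
      ((Metric.closedBall_subset_cthickening hx δ).trans hsub))
  have hψgu : ∀ x, ‖ψ x • ∇ (u k) x‖ ≤ S * L := fun x => by
    by_cases hx : x ∈ tsupport ψ
    · rw [norm_smul]
      exact mul_le_mul (hS x) (hgu x hx) (norm_nonneg _) hS0
    · rw [image_eq_zero_of_notMem_tsupport hx, zero_smul, norm_zero]
      positivity
  have hi1 : Integrable (fun x => u k x • ∇ ψ x) F.variation :=
    ((hu k).continuous.smul (continuous_gradient hψ.one.contDiff)).integrable_of_hasCompactSupport
      (hasCompactSupport_gradient hψ.hasCompactSupport).smul_left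
  have hi2 : Integrable (fun x => ψ x • ∇ (u k) x) F.variation :=
    Integrable.of_bound (hψ.contDiff.continuous.smul
      (continuous_gradient (hu1 k))).aestronglyMeasurable _ (Eventually.of_forall hψgu)
  have hprod : gradPairing F (fun x => u k x * ψ x) =
      ∫ᵛ x, u k x • ∇ ψ x ∂[innerSL ℝ; F] + ∫ᵛ x, ψ x • ∇ (u k) x ∂[innerSL ℝ; F] := by
    rw [← VectorMeasure.integral_fun_add hi1 hi2, gradPairing]
    simp only [gradient_mul ((hu1 k).differentiable one_ne_zero _) (hψ.one.differentiable _)]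
  have h1 : |gradPairing F (fun x => u k x * ψ x)| ≤ (divVariation Ω F).toReal * (M * S) :=
    abs_gradPairing_le hF (hψ.one.mul_left (hu1 k)) fun x => by
      rw [abs_mul]
      exact mul_le_mul (huM k x) (hS x) (abs_nonneg _) hM0
  have h2 : |∫ᵛ x, ψ x • ∇ (u k) x ∂[innerSL ℝ; F]| ≤ S * L * F.variation.real univ := by
    refine (norm_integral_innerSL_le _).trans ?_
    refine (integral_mono hi2.norm (integrable_const _) hψgu).trans_eq ?_
    rw [integral_const, smul_eq_mul, mul_comm]
  have e : ∫ᵛ x, u k x • ∇ ψ x ∂[innerSL ℝ; F] = gradPairing F (fun x => u k x * ψ x) -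
      ∫ᵛ x, ψ x • ∇ (u k) x ∂[innerSL ℝ; F] := by rw [hprod]; ring
  rw [e]
  refine (abs_sub _ _).trans ((add_le_add h1 h2).trans_eq ?_)
  ring

theorem exists_isDivergence_mulField (hΩ : IsOpen Ω) (hF : IsDMExt Ω F) (hφ : MemW1Infty Ω φ) :
    ∃ μ, IsDivergence Ω (mulField φ F) μ := by
  have := hF.isFiniteMeasure
  obtain ⟨C, hC⟩ := exists_abs_gradPairing_mulField_le hΩ hF hφ
  let ι : testSubmodule Ω →ₗ[ℝ] BoundedContinuousFunction (EuclideanSpace ℝ (Fin n)) ℝ :=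
    { toFun := fun ψ => toBounded ⟨⟨ψ.1, ψ.2.contDiff.continuous⟩, ψ.2.hasCompactSupport⟩
      map_add' := fun _ _ => rfl
      map_smul' := fun _ _ => rfl }
  let T : testSubmodule Ω →ₗ[ℝ] ℝ :=
    { toFun := fun ψ => -gradPairing (mulField φ F) ψ.1
      map_add' := fun f g => by
        have e : ∀ x, φ x • ∇ (f + g : testSubmodule Ω).1 x =
            φ x • ∇ f.1 x + φ x • ∇ g.1 x := fun x => by
          rw [← smul_add, ← gradient_add (f.2.one.differentiable x) (g.2.one.differentiable x)]
          rfl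
        rw [gradPairing_mulField hΩ hF hφ (f + g).2.one, gradPairing_mulField hΩ hF hφ f.2.one,
          gradPairing_mulField hΩ hF hφ g.2.one, ← neg_add, ← VectorMeasure.integral_fun_add
          (integrable_smul_gradient hΩ hF hφ f.2.one) (integrable_smul_gradient hΩ hF hφ g.2.one)]
        simp only [e]
      map_smul' := fun c f => by
        have := gradPairing_const_mul (F := mulField φ F) c f.2.one.differentiable
        change -gradPairing (mulField φ F) (fun x => c * f.1 x) = _
        simp [this] }
  obtain ⟨μ, hμ⟩ := exists_signedMeasure_of_bound ι (fun ψ => ψ.2.hasCompactSupport) T (C := C)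
    fun ψ => by
      change |-gradPairing (mulField φ F) ψ.1| ≤ _
      rw [abs_neg]
      exact hC ψ.1 ψ.2 _ fun x => (ι ψ).norm_coe_le_norm x
  -- The Riesz measure lives on the whole space; restricting it to `Ω` leaves integrals of functions
  -- supported in `Ω` unchanged.
  refine ⟨μ.restrict Ω, ?_, fun ψ hψ => ?_⟩
  · rw [VectorMeasure.variation_restrict hΩ.measurableSet]
    simp [Measure.restrict_apply hΩ.measurableSet.compl]
  · rw [← VectorMeasure.integral_indicator hΩ.measurableSet,
      indicator_eq_self.2 ((subset_tsupport ψ).trans hψ.tsupport_subset)]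
    exact hμ ⟨ψ, hψ⟩

theorem isDivergence_divergence (hΩ : IsOpen Ω) (hF : IsDMExt Ω F) (hφ : MemW1Infty Ω φ) :
    IsDivergence Ω (mulField φ F) (divergence Ω (mulField φ F)) := by
  have h := exists_isDivergence_mulField hΩ hF hφ
  rw [divergence, dif_pos h]
  exact h.choose_spec

end DMExt

end DivMeasure

/-! ### Smooth steps of the depth and the estimate on inner parallel sets. -/

namespace DivMeasure

section SmoothStep

/-- Each such `t`, including the endpoint `0`, is a global minimum. -/
theorem deriv_smoothTransition_of_nonpos {t : ℝ} (ht : t ≤ 0) :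
    deriv Real.smoothTransition t = 0 := by
  refine IsLocalMin.deriv_eq_zero (Eventually.of_forall fun y => ?_)
  rw [Real.smoothTransition.zero_of_nonpos ht]
  exact Real.smoothTransition.nonneg y

theorem deriv_smoothTransition_of_one_le {t : ℝ} (ht : 1 ≤ t) :
    deriv Real.smoothTransition t = 0 := by
  refine IsLocalMax.deriv_eq_zero (Eventually.of_forall fun y => ?_)
  rw [Real.smoothTransition.one_of_one_le ht]
  exact Real.smoothTransition.le_one y

theorem exists_abs_deriv_smoothTransition_le :
    ∃ C, 0 ≤ C ∧ ∀ t, |deriv Real.smoothTransition t| ≤ C := by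
  have hc : Continuous (deriv Real.smoothTransition) :=
    (Real.smoothTransition.contDiff (n := 1)).continuous_deriv le_rfl
  obtain ⟨C, hC⟩ := isCompact_Icc.exists_bound_of_continuousOn (s := Icc (0 : ℝ) 1) hc.continuousOn
  have hC0 : 0 ≤ C := (norm_nonneg _).trans (hC 0 (by simp))
  refine ⟨C, hC0, fun t => ?_⟩
  rcases le_or_gt t 0 with h0 | h0
  · rw [deriv_smoothTransition_of_nonpos h0, abs_zero]; exact hC0
  rcases le_or_gt 1 t with h1 | h1
  · rw [deriv_smoothTransition_of_one_le h1, abs_zero]; exact hC0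
  exact hC t ⟨h0.le, h1.le⟩

/-- A smooth function that increases from `0` to `1` on `[ε, ε + h]`. -/
noncomputable def smoothStep (ε h t : ℝ) : ℝ := Real.smoothTransition ((t - ε) / h)

theorem contDiff_smoothStep (ε h : ℝ) {m : ℕ∞} : ContDiff ℝ m (smoothStep ε h) :=
  Real.smoothTransition.contDiff.comp ((contDiff_id.sub contDiff_const).div_const h)

theorem abs_smoothStep_le (ε h t : ℝ) : |smoothStep ε h t| ≤ 1 := by
  rw [smoothStep, abs_of_nonneg (Real.smoothTransition.nonneg _)]
  exact Real.smoothTransition.le_one _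

theorem smoothStep_of_le {ε h t : ℝ} (hh : 0 < h) (ht : t ≤ ε) : smoothStep ε h t = 0 :=
  Real.smoothTransition.zero_of_nonpos (div_nonpos_of_nonpos_of_nonneg (by linarith) hh.le)

theorem smoothStep_of_ge {ε h t : ℝ} (hh : 0 < h) (ht : ε + h ≤ t) : smoothStep ε h t = 1 :=
  Real.smoothTransition.one_of_one_le ((one_le_div hh).2 (by linarith))

theorem deriv_smoothStep (ε h t : ℝ) :
    deriv (smoothStep ε h) t = deriv Real.smoothTransition ((t - ε) / h) / h := by
  have h1 : HasDerivAt (fun s : ℝ => (s - ε) / h) (1 / h) t :=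
    ((hasDerivAt_id t).sub_const ε).div_const h
  have h2 : HasDerivAt Real.smoothTransition _ ((t - ε) / h) :=
    ((Real.smoothTransition.contDiff (n := 1)).differentiable one_ne_zero _).hasDerivAt
  rw [div_eq_mul_one_div (deriv Real.smoothTransition _)]
  exact (h2.comp t h1).deriv

theorem deriv_smoothStep_eq_zero {ε h t : ℝ} (hh : 0 < h) (ht : t ∉ Ioo ε (ε + h)) :
    deriv (smoothStep ε h) t = 0 := by
  rw [deriv_smoothStep]
  rcases le_or_gt t ε with h0 | h0
  · rw [deriv_smoothTransition_of_nonpos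
      (div_nonpos_of_nonpos_of_nonneg (by linarith) hh.le), zero_div]
  · have h1 : ε + h ≤ t := not_lt.1 fun h1 => ht ⟨h0, h1⟩
    rw [deriv_smoothTransition_of_one_le ((one_le_div hh).2 (by linarith)), zero_div]

end SmoothStep

variable {n : ℕ} {Ω U : Set (EuclideanSpace ℝ (Fin n))}
  {F : VectorMeasure (EuclideanSpace ℝ (Fin n)) (EuclideanSpace ℝ (Fin n))}
  {φ ψ : EuclideanSpace ℝ (Fin n) → ℝ}

/-- The distance to the complement of a set. -/
noncomputable def depth (U : Set (EuclideanSpace ℝ (Fin n))) (x : EuclideanSpace ℝ (Fin n)) : ℝ :=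
  Metric.infDist x Uᶜ

theorem lipschitzWith_depth (U : Set (EuclideanSpace ℝ (Fin n))) : LipschitzWith 1 (depth U) :=
  Metric.lipschitz_infDist_pt _

theorem continuous_depth (U : Set (EuclideanSpace ℝ (Fin n))) : Continuous (depth U) :=
  (lipschitzWith_depth U).continuous

theorem mem_of_depth_pos {x : EuclideanSpace ℝ (Fin n)} (hx : 0 < depth U x) : x ∈ U := by
  by_contra h
  exact hx.ne' (Metric.infDist_zero_of_mem h)

/-- A nearest point of the complement lies on the frontier. The complement is nonempty since `ℝⁿ` is
not compact. Unlike the distance to the frontier, `depth` vanishes off `U`, so `U^ε` is one of its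
superlevel sets. -/
theorem infDist_frontier_eq_depth [Nonempty (Fin n)] (hU : IsOpen U)
    (hUc : IsCompact (closure U)) {x : EuclideanSpace ℝ (Fin n)} (hx : x ∈ U) :
    Metric.infDist x (frontier U) = depth U x := by
  have hne : U ≠ univ := by
    rintro rfl
    rw [closure_univ] at hUc
    exact noncompact_univ _ hUc
  obtain ⟨y, hy, hxy⟩ := exists_mem_frontier_infDist_compl_eq_dist hx hne
  refine le_antisymm ((Metric.infDist_le_dist_of_mem hy).trans_eq hxy.symm) ?_
  refine Metric.infDist_le_infDist_of_subset ?_ ⟨y, hy⟩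
  rw [hU.frontier_eq]
  exact fun z hz => hz.2

theorem innerSet_eq [Nonempty (Fin n)] (hU : IsOpen U) (hUc : IsCompact (closure U)) {ε : ℝ}
    (hε : 0 < ε) : innerSet U ε = {x | ε < depth U x} := by
  ext x
  constructor
  · rintro ⟨hx, hlt⟩
    rwa [infDist_frontier_eq_depth hU hUc hx] at hlt
  · intro hx
    have hxU := mem_of_depth_pos (hε.trans hx)
    refine ⟨hxU, ?_⟩
    rw [infDist_frontier_eq_depth hU hUc hxU]
    exact hx

theorem measurableSet_lt_depth (ε : ℝ) : MeasurableSet {x | ε < depth U x} :=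
  (isOpen_lt continuous_const (continuous_depth U)).measurableSet

theorem contDiff_mollify_depth (k : ℕ) : ContDiff ℝ ∞ (mollify (depth U) k) :=
  contDiff_mollify (continuous_depth U).locallyIntegrable k

theorem tendsto_mollify_depth (x : EuclideanSpace ℝ (Fin n)) :
    Tendsto (fun k => mollify (depth U) k x) atTop (𝓝 (depth U x)) :=
  tendsto_mollify (continuous_depth U).aestronglyMeasurable (continuous_depth U).continuousAt

theorem contDiff_smoothStep_mollify_depth (ε h : ℝ) (k : ℕ) :
    ContDiff ℝ ∞ fun x => smoothStep ε h (mollify (depth U) k x) :=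
  (contDiff_smoothStep ε h).comp (contDiff_mollify_depth k)

/-- Mollification moves the depth by at most `1 / (k + 1)`. Once this is below `ε`, the step can be
nonzero only where the depth itself is positive, hence inside `U`. -/
theorem eventually_isTest_smoothStep (hUc : IsCompact (closure U)) (hUΩ : closure U ⊆ Ω) {ε h : ℝ}
    (hε : 0 < ε) (hh : 0 < h) :
    ∀ᶠ k in atTop, IsTest ∞ Ω fun x => smoothStep ε h (mollify (depth U) k x) := by
  have hsmall : ∀ᶠ k : ℕ in atTop, 1 / ((k : ℝ) + 1) < ε :=
    tendsto_one_div_add_atTop_nhds_zero_nat.eventually (gt_mem_nhds hε)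
  filter_upwards [hsmall] with k hk
  have hsub : tsupport (fun x => smoothStep ε h (mollify (depth U) k x)) ⊆ closure U := by
    refine closure_mono fun x hx => ?_
    have h1 : ε < mollify (depth U) k x := by
      by_contra! hle
      exact hx (smoothStep_of_le hh hle)
    have h2 := (abs_le.1 (abs_mollify_sub_le (lipschitzWith_depth U) k x)).2
    exact mem_of_depth_pos (by linarith)
  exact ⟨contDiff_smoothStep_mollify_depth ε h k,
    hUc.of_isClosed_subset (isClosed_tsupport _) hsub, hsub.trans hUΩ⟩

theorem tendsto_integral_smoothStep_mollify (S : SignedMeasure (EuclideanSpace ℝ (Fin n)))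
    (ε h : ℝ) :
    Tendsto (fun k => ∫ᵛ x, smoothStep ε h (mollify (depth U) k x) ∂•S) atTop
      (𝓝 (∫ᵛ x, smoothStep ε h (depth U x) ∂•S)) :=
  VectorMeasure.tendsto_integral_filter_of_norm_le_const
    (Eventually.of_forall fun k =>
      (contDiff_smoothStep_mollify_depth ε h k).continuous.aestronglyMeasurable)
    ⟨1, Eventually.of_forall fun _ => Eventually.of_forall fun _ => abs_smoothStep_le _ _ _⟩
    (Eventually.of_forall fun x =>
      ((contDiff_smoothStep ε h (m := 0)).continuous.tendsto _).comp (tendsto_mollify_depth x))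

/-- Dominated convergence: the steps vanish where the depth is at most `ε`, so their pointwise limit
is the indicator of the strict superlevel set. -/
theorem tendsto_integral_smoothStep (S : SignedMeasure (EuclideanSpace ℝ (Fin n))) (ε : ℝ) :
    Tendsto (fun h => ∫ᵛ x, smoothStep ε h (depth U x) ∂•S) (𝓝[>] 0)
      (𝓝 (S {x | ε < depth U x})) := by
  rw [← integral_indicator_one_signedMeasure S (measurableSet_lt_depth ε)]
  refine VectorMeasure.tendsto_integral_filter_of_norm_le_const
    (Eventually.of_forall fun h => ((contDiff_smoothStep ε h (m := 0)).continuous.comp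
      (continuous_depth U)).aestronglyMeasurable)
    ⟨1, Eventually.of_forall fun _ => Eventually.of_forall fun _ => abs_smoothStep_le _ _ _⟩
    (Eventually.of_forall fun x => tendsto_const_nhds.congr' ?_)
  by_cases hx : ε < depth U x
  · have hsmall : ∀ᶠ h : ℝ in 𝓝[>] 0, h < depth U x - ε :=
      nhdsWithin_le_nhds (gt_mem_nhds (sub_pos.2 hx))
    filter_upwards [hsmall, self_mem_nhdsWithin] with h h1 h2
    rw [smoothStep_of_ge h2 (by linarith), indicator_of_mem (by exact hx), Pi.one_apply]
  · filter_upwards [self_mem_nhdsWithin] with h h2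
    rw [smoothStep_of_le h2 (not_lt.1 hx), indicator_of_notMem (by exact hx)]

/-- A signed measure annihilating all test functions in `Ω` vanishes on inner parallel sets. -/
theorem apply_lt_depth_eq_zero (hUc : IsCompact (closure U)) (hUΩ : closure U ⊆ Ω)
    {S : SignedMeasure (EuclideanSpace ℝ (Fin n))}
    (hS : ∀ ψ, IsTest ∞ Ω ψ → ∫ᵛ x, ψ x ∂•S = 0) {ε : ℝ} (hε : 0 < ε) :
    S {x | ε < depth U x} = 0 := by
  refine tendsto_nhds_unique (tendsto_integral_smoothStep S ε) (tendsto_const_nhds.congr' ?_)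
  filter_upwards [self_mem_nhdsWithin] with h hh
  refine tendsto_nhds_unique (tendsto_const_nhds.congr' ?_)
    (tendsto_integral_smoothStep_mollify S ε h)
  filter_upwards [eventually_isTest_smoothStep hUc hUΩ hε hh] with k hk
  exact (hS _ hk).symm

/-- For mollified depth the chain rule applies and the inner gradient has norm at most `1`. Letting
`k → ∞` removes the mollification from both sides without ever using a gradient of `depth`, which
need not exist almost everywhere for the variation of `F`. -/
theorem abs_integral_smoothStep_le (hΩ : IsOpen Ω) (hF : IsDMExt Ω F)
    (hUc : IsCompact (closure U)) (hUΩ : closure U ⊆ Ω) (hφ : MemW1Infty Ω φ)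
    {D : SignedMeasure (EuclideanSpace ℝ (Fin n))} (hD : IsDivergence Ω (mulField φ F) D) {ε h : ℝ}
    (hε : 0 < ε) (hh : 0 < h) :
    |∫ᵛ x, smoothStep ε h (depth U x) ∂•D| ≤
      ∫ x, |φ x| * |deriv (smoothStep ε h) (depth U x)| ∂F.variation := by
  have := hF.isFiniteMeasure
  obtain ⟨M, hM0, hM⟩ := hφ.exists_bound hΩ
  obtain ⟨C, hC0, hC⟩ := exists_abs_deriv_smoothTransition_le
  have hφm := hF.aestronglyMeasurable hΩ hφ.continuousOn
  have hdc : Continuous (deriv (smoothStep ε h)) :=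
    (contDiff_smoothStep ε h (m := 1)).continuous_deriv le_rfl
  have hdb : ∀ t, |deriv (smoothStep ε h) t| ≤ C / h := fun t => by
    rw [deriv_smoothStep, abs_div, abs_of_pos hh]
    gcongr
    exact hC _
  have hmeas : ∀ {v : EuclideanSpace ℝ (Fin n) → ℝ}, Continuous v →
      AEStronglyMeasurable (fun x => |φ x| * |deriv (smoothStep ε h) (v x)|) F.variation :=
    fun hv => hφm.norm.mul (hdc.comp hv).norm.aestronglyMeasurable
  have hbound : ∀ v : EuclideanSpace ℝ (Fin n) → ℝ,
      ∀ᵐ x ∂F.variation, ‖|φ x| * |deriv (smoothStep ε h) (v x)|‖ ≤ M * (C / h) := fun v => by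
    filter_upwards [hF.ae_mem] with x hx
    rw [Real.norm_of_nonneg (by positivity)]
    exact mul_le_mul (hM x hx) (hdb _) (abs_nonneg _) hM0
  have hlim : Tendsto (fun k => ∫ x, |φ x| *
      |deriv (smoothStep ε h) (mollify (depth U) k x)| ∂F.variation) atTop
      (𝓝 (∫ x, |φ x| * |deriv (smoothStep ε h) (depth U x)| ∂F.variation)) :=
    tendsto_integral_of_dominated_convergence (fun _ => M * (C / h))
      (fun k => hmeas (contDiff_mollify_depth k).continuous) (integrable_const _)
      (fun k => hbound _) (Eventually.of_forall fun x =>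
        (((hdc.tendsto _).comp (tendsto_mollify_depth x)).abs).const_mul _)
  refine le_of_tendsto_of_tendsto (tendsto_integral_smoothStep_mollify D ε h).abs hlim ?_
  filter_upwards [eventually_isTest_smoothStep hUc hUΩ hε hh] with k hk
  rw [hD.integral_eq _ hk, abs_neg, gradPairing_mulField hΩ hF hφ hk.one]
  refine (norm_integral_innerSL_le _).trans ?_
  refine integral_mono_ae (integrable_smul_gradient hΩ hF hφ hk.one).norm
    (Integrable.of_bound (hmeas (contDiff_mollify_depth k).continuous) _ (hbound _))
    (Eventually.of_forall fun x => ?_)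
  have hdiff : DifferentiableAt ℝ (mollify (depth U) k) x :=
    (contDiff_mollify_depth k).differentiable (by simp) x
  have hdiff' : DifferentiableAt ℝ (smoothStep ε h) (mollify (depth U) k x) :=
    (contDiff_smoothStep ε h (m := 1)).differentiable one_ne_zero _
  simp only [norm_smul, gradient_comp hdiff' hdiff, Real.norm_eq_abs]
  gcongr
  exact mul_le_of_le_one_right (abs_nonneg _)
    (norm_gradient_mollify_le_one (lipschitzWith_depth U) k x)

/-- The distribution function of the depth with respect to a finite measure. -/
noncomputable def depthDistribution (ν : Measure (EuclideanSpace ℝ (Fin n)))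
    (U : Set (EuclideanSpace ℝ (Fin n))) (t : ℝ) : ℝ :=
  ν.real {x | depth U x ≤ t}

theorem monotone_depthDistribution (ν : Measure (EuclideanSpace ℝ (Fin n))) [IsFiniteMeasure ν] :
    Monotone (depthDistribution ν U) :=
  fun _ _ h => measureReal_mono fun _ hx => le_trans (by exact hx) h

theorem measureReal_depth_Ioo_le (ν : Measure (EuclideanSpace ℝ (Fin n))) [IsFiniteMeasure ν]
    (ε : ℝ) {h : ℝ} (hh : 0 ≤ h) :
    ν.real {x | depth U x ∈ Ioo ε (ε + h)} ≤
      depthDistribution ν U (ε + h) - depthDistribution ν U ε := by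
  have hm : MeasurableSet {x | depth U x ∈ Ioo ε (ε + h)} :=
    (continuous_depth U).measurable measurableSet_Ioo
  rw [le_sub_iff_add_le, depthDistribution, depthDistribution, ← measureReal_union' _ hm]
  · refine measureReal_mono ?_
    rintro x (hx | hx)
    · exact hx.2.le
    · exact (show depth U x ≤ ε from hx).trans (by linarith)
  · exact disjoint_left.2 fun x hx hx' => not_lt.2 (by exact hx') hx.1

/-- Near the boundary of an inner parallel set, a continuous function is almost bounded by its
supremum on that boundary. -/
theorem exists_forall_depth_Ioo_abs_lt (hΩ : IsOpen Ω) (hUc : IsCompact (closure U))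
    (hUΩ : closure U ⊆ Ω) (hφ : ContinuousOn φ Ω) {ε s s' : ℝ} (hε : 0 < ε)
    (hs : ∀ x ∈ frontier {x | ε < depth U x}, |φ x| ≤ s) (hss' : s < s') :
    ∃ h₀ > 0, ∀ x, depth U x ∈ Ioo ε (ε + h₀) → |φ x| < s' := by
  have hsubU : {x | ε < depth U x} ⊆ U := fun x hx => mem_of_depth_pos (hε.trans hx)
  have hopenU : IsOpen {x | ε < depth U x} := isOpen_lt continuous_const (continuous_depth U)
  set W := Ω ∩ (fun x => |φ x|) ⁻¹' Iio s'
  have hW : IsOpen W := hφ.abs.isOpen_inter_preimage hΩ isOpen_Iio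
  -- `K` is compact and misses the frontier, so the depth attains on it a minimum above `ε`; thinner
  -- layers avoid `K`.
  set K := closure {x | ε < depth U x} \ W
  have hK : IsCompact K :=
    (hUc.of_isClosed_subset isClosed_closure (closure_mono hsubU)).diff hW
  have hKlt : ∀ x ∈ K, ε < depth U x := fun x hx => by
    by_contra hnot
    have hxf : x ∈ frontier {x | ε < depth U x} := by
      rw [hopenU.frontier_eq]; exact ⟨hx.1, hnot⟩
    exact hx.2 ⟨hUΩ (closure_mono hsubU hx.1), (hs x hxf).trans_lt hss'⟩
  have key : ∀ x, ε < depth U x → x ∉ K → |φ x| < s' := fun x hx hxK => by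
    by_contra hnot
    exact hxK ⟨subset_closure hx, fun hxW => hnot hxW.2⟩
  rcases K.eq_empty_or_nonempty with hKe | hKne
  · exact ⟨1, one_pos, fun x hx => key x hx.1 (by simp [hKe])⟩
  obtain ⟨y, hyK, hy⟩ := hK.exists_isMinOn hKne (continuous_depth U).continuousOn
  refine ⟨depth U y - ε, sub_pos.2 (hKlt y hyK), fun x hx => key x hx.1 fun hxK => ?_⟩
  have h1 : depth U y ≤ depth U x := hy hxK
  have h2 := hx.2
  linarith

/-- At points of differentiability of the depth distribution, the normal trace on the boundary of
the inner parallel set is bounded with respect to the supremum norm on that boundary. -/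
theorem exists_abs_divergence_lt_depth_le (hΩ : IsOpen Ω) (hF : IsDMExt Ω F)
    (hUc : IsCompact (closure U)) (hUΩ : closure U ⊆ Ω) {ε : ℝ} (hε : 0 < ε)
    (hdiff : DifferentiableAt ℝ (depthDistribution F.variation U) ε) :
    ∃ C, 0 ≤ C ∧ ∀ φ, MemW1Infty Ω φ → ∀ D, IsDivergence Ω (mulField φ F) D → ∀ s, 0 ≤ s →
      (∀ x ∈ frontier {x | ε < depth U x}, |φ x| ≤ s) → |D {x | ε < depth U x}| ≤ C * s := by
  have := hF.isFiniteMeasure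
  obtain ⟨C, hC0, hC⟩ := exists_abs_deriv_smoothTransition_le
  set m := depthDistribution F.variation U with hm
  -- The `+ 1` leaves room for difference quotients of `m` at small `h > 0`. The constant is fixed
  -- before `φ`.
  refine ⟨C * (|deriv m ε| + 1), by positivity, fun φ hφ D hD s hs0 hs => ?_⟩
  have hslope : ∀ᶠ h : ℝ in 𝓝[>] 0, h⁻¹ * (m (ε + h) - m ε) < |deriv m ε| + 1 := by
    have h1 := hdiff.hasDerivAt.tendsto_slope_zero_right
    simp only [smul_eq_mul] at h1
    exact h1.eventually (gt_mem_nhds (by linarith [le_abs_self (deriv m ε)]))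
  -- On the frontier `|φ|` is at most `s`, but on thin layers only below each `s' > s`; hence the
  -- final limit `s' ↓ s`.
  have hlim : Tendsto (fun s' => C * (|deriv m ε| + 1) * s') (𝓝[>] s)
      (𝓝 (C * (|deriv m ε| + 1) * s)) :=
    ((continuous_const.mul continuous_id).tendsto s).mono_left nhdsWithin_le_nhds
  refine ge_of_tendsto hlim ?_
  filter_upwards [self_mem_nhdsWithin] with s' hs'
  have hs'0 : 0 ≤ s' := hs0.trans (le_of_lt hs')
  obtain ⟨h₀, hh₀, hφs⟩ := exists_forall_depth_Ioo_abs_lt hΩ hUc hUΩ hφ.continuousOn hε hs hs'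
  refine le_of_tendsto (tendsto_integral_smoothStep D ε).abs ?_
  filter_upwards [hslope, self_mem_nhdsWithin, nhdsWithin_le_nhds (gt_mem_nhds hh₀)]
    with h h1 hh h2
  have hh : 0 < h := hh
  have hmeas : MeasurableSet {x | depth U x ∈ Ioo ε (ε + h)} :=
    (continuous_depth U).measurable measurableSet_Ioo
  refine (abs_integral_smoothStep_le hΩ hF hUc hUΩ hφ hD hε hh).trans ?_
  calc ∫ x, |φ x| * |deriv (smoothStep ε h) (depth U x)| ∂F.variation
      ≤ ∫ x, {x | depth U x ∈ Ioo ε (ε + h)}.indicator (fun _ => s' * (C / h)) x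
          ∂F.variation := by
        refine integral_mono_of_nonneg (Eventually.of_forall fun x => by positivity)
          ((integrable_const _).indicator hmeas) (Eventually.of_forall fun x => ?_)
        by_cases hx : depth U x ∈ Ioo ε (ε + h)
        · rw [indicator_of_mem (by exact hx)]
          refine mul_le_mul (hφs x ⟨hx.1, hx.2.trans (by linarith)⟩).le ?_ (abs_nonneg _) hs'0
          rw [deriv_smoothStep, abs_div, abs_of_pos hh]
          gcongr
          exact hC _
        · rw [indicator_of_notMem (by exact hx)]
          simp [deriv_smoothStep_eq_zero hh hx]
    _ = F.variation.real {x | depth U x ∈ Ioo ε (ε + h)} * (s' * (C / h)) := by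
        rw [integral_indicator hmeas, setIntegral_const, smul_eq_mul]
    _ ≤ (m (ε + h) - m ε) * (s' * (C / h)) := by
        gcongr
        exact measureReal_depth_Ioo_le _ _ hh.le
    _ = C * (h⁻¹ * (m (ε + h) - m ε)) * s' := by ring
    _ ≤ C * (|deriv m ε| + 1) * s' := by gcongr

end DivMeasure

/-! ### Linearity, representation and convergence of the trace. -/

namespace DivMeasure

variable {n : ℕ} {Ω U : Set (EuclideanSpace ℝ (Fin n))}
  {F : VectorMeasure (EuclideanSpace ℝ (Fin n)) (EuclideanSpace ℝ (Fin n))}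
  {φ ψ : EuclideanSpace ℝ (Fin n) → ℝ}

theorem IsTest.integrable (hψ : IsTest ∞ Ω ψ) (S : SignedMeasure (EuclideanSpace ℝ (Fin n))) :
    Integrable ψ S.variation :=
  hψ.contDiff.continuous.integrable_of_hasCompactSupport hψ.hasCompactSupport

theorem MemW1Infty.add (hφ : MemW1Infty Ω φ) (hψ : MemW1Infty Ω ψ) : MemW1Infty Ω (φ + ψ) :=
  (w1InftySubmodule Ω).add_mem hφ hψ

theorem MemW1Infty.const_smul (c : ℝ) (hφ : MemW1Infty Ω φ) : MemW1Infty Ω (c • φ) :=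
  (w1InftySubmodule Ω).smul_mem c hφ

/-- `divergence` is picked by choice, so additivity is not formal: the difference of the two sides
annihilates every test function and hence vanishes on the superlevel set. -/
theorem divergence_mulField_add (hΩ : IsOpen Ω) (hF : IsDMExt Ω F) (hUc : IsCompact (closure U))
    (hUΩ : closure U ⊆ Ω) (hφ : MemW1Infty Ω φ) (hψ : MemW1Infty Ω ψ) {ε : ℝ} (hε : 0 < ε) :
    divergence Ω (mulField (φ + ψ) F) {x | ε < depth U x} =
      divergence Ω (mulField φ F) {x | ε < depth U x} +
      divergence Ω (mulField ψ F) {x | ε < depth U x} := by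
  have hS := apply_lt_depth_eq_zero (S := divergence Ω (mulField (φ + ψ) F) -
    (divergence Ω (mulField φ F) + divergence Ω (mulField ψ F))) hUc hUΩ (fun χ hχ => ?_) hε
  · rw [sub_apply, add_apply, sub_eq_zero] at hS
    exact hS
  rw [VectorMeasure.integral_sub_vectorMeasure (hχ.integrable _) (hχ.integrable _),
    VectorMeasure.integral_add_vectorMeasure (hχ.integrable _) (hχ.integrable _),
    (isDivergence_divergence hΩ hF (hφ.add hψ)).integral_eq χ hχ,
    (isDivergence_divergence hΩ hF hφ).integral_eq χ hχ,
    (isDivergence_divergence hΩ hF hψ).integral_eq χ hχ,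
    gradPairing_mulField hΩ hF (hφ.add hψ) hχ.one, gradPairing_mulField hΩ hF hφ hχ.one,
    gradPairing_mulField hΩ hF hψ hχ.one]
  simp only [Pi.add_apply, add_smul]
  rw [VectorMeasure.integral_fun_add (integrable_smul_gradient hΩ hF hφ hχ.one)
    (integrable_smul_gradient hΩ hF hψ hχ.one)]
  ring

theorem divergence_mulField_smul (hΩ : IsOpen Ω) (hF : IsDMExt Ω F) (hUc : IsCompact (closure U))
    (hUΩ : closure U ⊆ Ω) (hφ : MemW1Infty Ω φ) (c : ℝ) {ε : ℝ} (hε : 0 < ε) :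
    divergence Ω (mulField (c • φ) F) {x | ε < depth U x} =
      c * divergence Ω (mulField φ F) {x | ε < depth U x} := by
  have hS := apply_lt_depth_eq_zero (S := divergence Ω (mulField (c • φ) F) -
    c • divergence Ω (mulField φ F)) hUc hUΩ (fun χ hχ => ?_) hε
  · rw [sub_apply, smul_apply, smul_eq_mul, sub_eq_zero] at hS
    exact hS
  rw [VectorMeasure.integral_sub_vectorMeasure (hχ.integrable _) (hχ.integrable _),
    VectorMeasure.integral_smul_vectorMeasure,
    (isDivergence_divergence hΩ hF (hφ.const_smul c)).integral_eq χ hχ,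
    (isDivergence_divergence hΩ hF hφ).integral_eq χ hχ,
    gradPairing_mulField hΩ hF (hφ.const_smul c) hχ.one, gradPairing_mulField hΩ hF hφ hχ.one]
  simp only [Pi.smul_apply, smul_assoc]
  rw [VectorMeasure.integral_fun_smul, smul_neg, sub_self]

/-- At points of differentiability of the depth distribution, the normal trace on the boundary of
the inner parallel set is represented by a measure on that boundary. -/
theorem exists_normalTrace_measure [Nonempty (Fin n)] (hΩ : IsOpen Ω) (hF : IsDMExt Ω F)
    (hU : IsOpen U) (hUc : IsCompact (closure U)) (hUΩ : closure U ⊆ Ω) {ε : ℝ} (hε : 0 < ε)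
    (hdiff : DifferentiableAt ℝ (depthDistribution F.variation U) ε) :
    ∃ σ : SignedMeasure (EuclideanSpace ℝ (Fin n)),
      σ.variation (frontier (innerSet U ε))ᶜ = 0 ∧
      ∀ φ, MemW1Infty Ω φ → normalTrace Ω F (innerSet U ε) φ =
        ∫ᵛ x in frontier (innerSet U ε), φ x ∂•σ := by
  rw [innerSet_eq hU hUc hε]
  set A := {x | ε < depth U x}
  set K := frontier A
  have hKU : K ⊆ closure U := frontier_subset_closure.trans
    (closure_mono fun x hx => mem_of_depth_pos (hε.trans hx))
  have hK : IsClosed K := isClosed_frontier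
  have hKc : CompactSpace K := isCompact_iff_compactSpace.1 (hUc.of_isClosed_subset hK hKU)
  have hcont : ∀ φ : w1InftySubmodule Ω, Continuous (K.domRestrict φ.1) := fun φ =>
    (φ.2.continuousOn.mono (hKU.trans hUΩ)).domRestrict
  let ι : w1InftySubmodule Ω →ₗ[ℝ] BoundedContinuousFunction K ℝ :=
    { toFun := fun φ => BoundedContinuousFunction.mkOfCompact ⟨K.domRestrict φ.1, hcont φ⟩
      map_add' := fun _ _ => rfl
      map_smul' := fun _ _ => rfl }
  let T : w1InftySubmodule Ω →ₗ[ℝ] ℝ :=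
    { toFun := fun φ => normalTrace Ω F A φ.1
      map_add' := fun f g => by
        simp only [normalTrace, Submodule.coe_add]
        rw [divergence_mulField_add hΩ hF hUc hUΩ f.2 g.2 hε, neg_add]
      map_smul' := fun c f => by
        simp only [normalTrace, Submodule.coe_smul, RingHom.id_apply, smul_eq_mul]
        rw [divergence_mulField_smul hΩ hF hUc hUΩ f.2 c hε, mul_neg] }
  obtain ⟨C, hC0, hC⟩ := exists_abs_divergence_lt_depth_le hΩ hF hUc hUΩ hε hdiff
  obtain ⟨τ, hτ⟩ := exists_signedMeasure_of_bound ι (fun _ => HasCompactSupport.of_compactSpace _)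
    T (C := C) fun φ => by
      change |-divergence Ω (mulField φ.1 F) A| ≤ _
      rw [abs_neg]
      exact hC φ.1 φ.2 _ (isDivergence_divergence hΩ hF φ.2) _ (norm_nonneg _)
        fun x hx => (ι φ).norm_coe_le_norm ⟨x, hx⟩
  have hemb : IsClosedEmbedding (Subtype.val : K → EuclideanSpace ℝ (Fin n)) :=
    hK.isClosedEmbedding_subtypeVal
  -- `τ` lives on the frontier as a subtype; its image under the inclusion is automatically
  -- concentrated there.
  refine ⟨τ.map Subtype.val, ?_, fun φ hφ => ?_⟩
  · rw [hemb.measurableEmbedding.variation_map, hemb.measurableEmbedding.map_apply]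
    have : (Subtype.val : K → EuclideanSpace ℝ (Fin n)) ⁻¹' Kᶜ = ∅ := by
      ext x; simp
    rw [this, measure_empty]
  · rw [← VectorMeasure.integral_indicator hK.measurableSet, hemb.integral_map_vectorMeasure]
    have h1 : ∀ x : K, K.indicator φ x = ι ⟨φ, hφ⟩ x := fun x => indicator_of_mem x.2 φ
    simp only [h1]
    exact (hτ ⟨φ, hφ⟩).symm

/-- Since `U` is where the depth is positive, the indicators converge pointwise; `ε` need not be
monotone. -/
theorem tendsto_apply_innerSet [Nonempty (Fin n)] (hU : IsOpen U) (hUc : IsCompact (closure U))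
    (D : SignedMeasure (EuclideanSpace ℝ (Fin n))) {ε : ℕ → ℝ} (hε : ∀ k, 0 < ε k)
    (hlim : Tendsto ε atTop (𝓝 0)) :
    Tendsto (fun k => D (innerSet U (ε k))) atTop (𝓝 (D U)) := by
  have hne : Uᶜ.Nonempty := by
    rw [nonempty_compl]
    rintro rfl
    rw [closure_univ] at hUc
    exact noncompact_univ _ hUc
  simp only [innerSet_eq hU hUc (hε _)]
  simp only [← integral_indicator_one_signedMeasure D (measurableSet_lt_depth _),
    ← integral_indicator_one_signedMeasure D hU.measurableSet]
  refine VectorMeasure.tendsto_integral_filter_of_norm_le_const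
    (Eventually.of_forall fun k => (aestronglyMeasurable_const (b := (1 : ℝ))).indicator
      (measurableSet_lt_depth _))
    ⟨1, Eventually.of_forall fun k => Eventually.of_forall fun x => ?_⟩
    (Eventually.of_forall fun x => tendsto_const_nhds.congr' ?_)
  · refine (norm_indicator_le_norm_self _ _).trans ?_
    simp
  by_cases hx : x ∈ U
  · have hpos : 0 < depth U x :=
      (hU.isClosed_compl.notMem_iff_infDist_pos hne).1 (by simpa using hx)
    filter_upwards [hlim.eventually (gt_mem_nhds hpos)] with k hk
    rw [indicator_of_mem hx, indicator_of_mem (by exact hk)]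
  · refine Eventually.of_forall fun k => ?_
    rw [indicator_of_notMem hx]
    refine (indicator_of_notMem (s := {y | ε k < depth U y}) (fun h => ?_) 1).symm
    exact hx (mem_of_depth_pos ((hε k).trans h))

end DivMeasure

theorem theorem3p4 (n : ℕ) (hn : 2 ≤ n)
    (Ω : Set (EuclideanSpace ℝ (Fin n))) (hΩ : IsOpen Ω)
    (F : VectorMeasure (EuclideanSpace ℝ (Fin n)) (EuclideanSpace ℝ (Fin n)))
    (hF : DivMeasure.IsDMExt Ω F)
    (U : Set (EuclideanSpace ℝ (Fin n))) (hU : IsOpen U)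
    (hUcompact : IsCompact (closure U)) (hUΩ : closure U ⊆ Ω) :
    ∃ N : Set ℝ, N ⊆ Ioi 0 ∧ volume N = 0 ∧
      ∃ σ : ℝ → SignedMeasure (EuclideanSpace ℝ (Fin n)),
        (∀ ε : ℝ, 0 < ε → ε ∉ N →
          (σ ε).variation (frontier (DivMeasure.innerSet U ε))ᶜ = 0 ∧
          ∀ φ : EuclideanSpace ℝ (Fin n) → ℝ, DivMeasure.MemW1Infty Ω φ →
            DivMeasure.normalTrace Ω F (DivMeasure.innerSet U ε) φ =
              ∫ᵛ x in frontier (DivMeasure.innerSet U ε), φ x ∂•(σ ε)) ∧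
        ∀ ε : ℕ → ℝ, (∀ k, 0 < ε k ∧ ε k ∉ N) → Tendsto ε atTop (𝓝 0) →
          ∀ φ : EuclideanSpace ℝ (Fin n) → ℝ, DivMeasure.MemW1Infty Ω φ →
            Tendsto
              (fun k => ∫ᵛ x in frontier (DivMeasure.innerSet U (ε k)), φ x ∂•(σ (ε k)))
              atTop (𝓝 (DivMeasure.normalTrace Ω F U φ)) := by
  have : Nonempty (Fin n) := ⟨⟨0, by omega⟩⟩
  have := hF.isFiniteMeasure
  have hex : ∀ ε : ℝ, ∃ σ : SignedMeasure (EuclideanSpace ℝ (Fin n)), 0 < ε →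
      DifferentiableAt ℝ (DivMeasure.depthDistribution F.variation U) ε →
      σ.variation (frontier (DivMeasure.innerSet U ε))ᶜ = 0 ∧
      ∀ φ, DivMeasure.MemW1Infty Ω φ → DivMeasure.normalTrace Ω F (DivMeasure.innerSet U ε) φ =
        ∫ᵛ x in frontier (DivMeasure.innerSet U ε), φ x ∂•σ := fun ε => by
    by_cases h : 0 < ε ∧ DifferentiableAt ℝ (DivMeasure.depthDistribution F.variation U) ε
    · obtain ⟨σ, hσ⟩ :=
        DivMeasure.exists_normalTrace_measure hΩ hF hU hUcompact hUΩ h.1 h.2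
      exact ⟨σ, fun _ _ => hσ⟩
    · exact ⟨0, fun h1 h2 => absurd ⟨h1, h2⟩ h⟩
  choose σ hσ using hex
  have hσ' : ∀ ε : ℝ, 0 < ε → ε ∉ {ε : ℝ | 0 < ε ∧
      ¬DifferentiableAt ℝ (DivMeasure.depthDistribution F.variation U) ε} → _ :=
    fun ε hε hεN => hσ ε hε (by_contra fun h => hεN ⟨hε, h⟩)
  refine ⟨_, fun ε hε => hε.1, ?_, σ, hσ', fun ε hε hlim φ hφ => ?_⟩
  -- Lebesgue's theorem: a monotone function is differentiable almost everywhere. The exceptional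
  -- set depends on `F` and `U`, but not on `φ`.
  · exact measure_mono_null (fun ε hε => hε.2)
      (DivMeasure.monotone_depthDistribution F.variation (U := U)).ae_differentiableAt
  · refine (DivMeasure.tendsto_apply_innerSet hU hUcompact
      (DivMeasure.divergence Ω (DivMeasure.mulField φ F)) (fun k => (hε k).1) hlim).neg.congr
      fun k => ?_
    exact (hσ' (ε k) (hε k).1 (hε k).2).2 φ hφ
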